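/- Let $\mathbf K_0$ be a connected compact Lie group with Lie algebra $\mathfrak k_0$, let $\mathfrak k=\mathbb C\otimes_{\mathbb R}\mathfrak k_0$ with conjugation $X\mapsto\bar X$ with respect to $\mathfrak k_0$, let $\mathbf M_0$ be a closed subgroup of $\mathbf K_0$ and $\mathfrak v$ a complex Lie subalgebra of $\mathfrak k$ (for instance the isotropy subgroup and the $CR$ algebra at a point of a $\mathbf K_0$-homogeneous $CR$ manifold). A subalgebra of $\mathfrak k$ is parabolic if it contains a Borel (maximal solvable) subalgebra of $\mathfrak k$. Let $\mathfrak n_r(\mathfrak v)$ be the set of those $X$ in the radical of $\mathfrak v$ for which $X\in[\mathfrak k,\mathfrak k]$ and $\mathrm{ad}_{\mathfrak k}(X)$ is nilpotent, and put $\mathfrak L(\mathfrak q)=\mathfrak q\cap\bar{\mathfrak q}$. Let $\mathrm{Par}(\mathfrak v,\mathbf M_0)$ be the set of parabolic subalgebras $\mathfrak q$ of $\mathfrak k$ such that $\mathfrak v\subset\mathfrak q$, $\mathfrak n_r(\mathfrak v)\cap\mathfrak L(\mathfrak q)=\{0\}$, and $\mathrm{Ad}_{\mathfrak k}(g)(\mathfrak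 q)=\mathfrak q$ for all $g\in\mathbf M_0$. For $A\in\mathfrak k_0$ set $$\mathfrak q_A=\sum_{\lambda\ge 0}\{X\in\mathfrak k\mid [A,X]=i\lambda X\},$$ where $\lambda$ ranges over the non-negative real numbers, and set $$\mathfrak a_0(\mathbf M_0)=\{A\in\mathfrak k_0\mid \mathrm{Ad}(g)(A)=A\ \ \forall g\in\mathbf M_0\}.$$ Then $$\mathrm{Par}(\mathfrak v,\mathbf M_0)=\{\mathfrak q_A\mid A\in\mathfrak a_0(\mathbf M_0),\ \mathfrak v\subset\mathfrak q_A,\ \mathfrak n_r(\mathfrak v)\cap\mathfrak L(\mathfrak q_A)=\{0\}\}.$$ Moreover, without the condition on $\mathfrak n_r(\mathfrak v)$ on either side: the set of all parabolic subalgebras $\mathfrak q$ of $\mathfrak k$ with $\mathfrak v\subset\mathfrak q$ and $\mathrm{Ad}_{\mathfrak k}(g)(\mathfrak q)=\mathfrak q$ for all $g\in\mathbf M_0$ is exactly $\{\mathfrak q_A\mid A\in\mathfrak a_0(\mathbf M_0),\ \mathfrak v\subset\mathfrak q_A\}$. -/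

import Mathlib

open scoped Manifold ContDiff TensorProduct

noncomputable section

namespace CRLie

/-! ### Parabolic subalgebras and nilpotent elements -/

/-- A Borel subalgebra: a maximal solvable subalgebra. -/
def IsBorel {𝔨 : Type*} [LieRing 𝔨] [LieAlgebra ℂ 𝔨] (𝔟 : LieSubalgebra ℂ 𝔨) : Prop :=
  Maximal (fun 𝔰 : LieSubalgebra ℂ 𝔨 => LieAlgebra.IsSolvable 𝔰) 𝔟

/-- A parabolic subalgebra: a subalgebra containing a Borel subalgebra. -/
def IsParabolic {𝔨 : Type*} [LieRing 𝔨] [LieAlgebra ℂ 𝔨] (𝔮 : LieSubalgebra ℂ 𝔨) : Prop :=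
  ∃ 𝔟 : LieSubalgebra ℂ 𝔨, IsBorel 𝔟 ∧ 𝔟 ≤ 𝔮

/-- `X` is a nilpotent element of the reductive Lie algebra `𝔨`: it belongs to `[𝔨, 𝔨]` and
`ad X` is a nilpotent endomorphism of `𝔨`. -/
def IsNilpotentElement {𝔨 : Type*} [LieRing 𝔨] [LieAlgebra ℂ 𝔨] (X : 𝔨) : Prop :=
  X ∈ LieAlgebra.derivedSeries ℂ 𝔨 1 ∧ IsNilpotent (LieAlgebra.ad ℂ 𝔨 X)

/-- `𝔫_r(𝔳)`: the elements of the radical of `𝔳` that are nilpotent elements of `𝔨`. -/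
def nilr {𝔨 : Type*} [LieRing 𝔨] [LieAlgebra ℂ 𝔨] (𝔳 : LieSubalgebra ℂ 𝔨) : Set 𝔨 :=
  {X | (∃ Y : 𝔳, Y ∈ LieAlgebra.radical ℂ 𝔳 ∧ (Y : 𝔨) = X) ∧ IsNilpotentElement X}

/-! ### The sum of the eigenspaces with non-negative imaginary eigenvalue -/

/-- The linear span `∑_{l ≥ 0} {X ∈ 𝔨 | [H, X] = i l X}`. -/
def nonnegEigenSubmodule {𝔨 : Type*} [LieRing 𝔨] [LieAlgebra ℂ 𝔨] (H : 𝔨) : Submodule ℂ 𝔨 :=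
  ⨆ l : {x : ℝ // 0 ≤ x},
    Module.End.eigenspace (LieAlgebra.ad ℂ 𝔨 H) (Complex.I * ((l : ℝ) : ℂ))

theorem lie_mem_nonnegEigenSubmodule {𝔨 : Type*} [LieRing 𝔨] [LieAlgebra ℂ 𝔨] (H : 𝔨)
    {X Y : 𝔨} (hX : X ∈ nonnegEigenSubmodule H) (hY : Y ∈ nonnegEigenSubmodule H) :
    ⁅X, Y⁆ ∈ nonnegEigenSubmodule H := by
  refine Submodule.iSup_induction _ (motive := fun X => ⁅X, Y⁆ ∈ nonnegEigenSubmodule H) hX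
    (fun l X hX => ?_) (by simp) (fun X X' h h' => by rw [add_lie]; exact add_mem h h')
  refine Submodule.iSup_induction _ (motive := fun Y => ⁅X, Y⁆ ∈ nonnegEigenSubmodule H) hY
    (fun m Y hY => ?_) (by simp) (fun Y Y' h h' => by rw [lie_add]; exact add_mem h h')
  rw [Module.End.mem_eigenspace_iff, LieAlgebra.ad_apply] at hX hY
  refine Submodule.mem_iSup_of_mem ⟨l + m, add_nonneg l.2 m.2⟩ ?_
  rw [Module.End.mem_eigenspace_iff, LieAlgebra.ad_apply, leibniz_lie, hX, hY, smul_lie,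
    lie_smul, ← add_smul]
  push_cast
  rw [mul_add]

/-- The same span as a Lie subalgebra. -/
def nonnegEigen {𝔨 : Type*} [LieRing 𝔨] [LieAlgebra ℂ 𝔨] (H : 𝔨) : LieSubalgebra ℂ 𝔨 :=
  { nonnegEigenSubmodule H with lie_mem' := fun hX hY => lie_mem_nonnegEigenSubmodule H hX hY }

/-! ### The complexification of a real Lie algebra -/

/-- Conjugation of `ℂ ⊗ 𝔨₀` with respect to the real form `𝔨₀`: `z ⊗ X ↦ z̄ ⊗ X`. -/
def conjC (𝔨₀ : Type*) [LieRing 𝔨₀] [LieAlgebra ℝ 𝔨₀] :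
    (ℂ ⊗[ℝ] 𝔨₀) →ₗ[ℝ] (ℂ ⊗[ℝ] 𝔨₀) :=
  LinearMap.rTensor 𝔨₀ Complex.conjAe.toLinearMap

/-- `𝔏(𝔮) = 𝔮 ∩ 𝔮̄`. -/
def leviPart {𝔨₀ : Type*} [LieRing 𝔨₀] [LieAlgebra ℝ 𝔨₀]
    (𝔮 : LieSubalgebra ℂ (ℂ ⊗[ℝ] 𝔨₀)) : Set (ℂ ⊗[ℝ] 𝔨₀) :=
  (𝔮 : Set (ℂ ⊗[ℝ] 𝔨₀)) ∩ conjC 𝔨₀ '' (𝔮 : Set (ℂ ⊗[ℝ] 𝔨₀))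

/-- The subalgebra `𝔮_A`, the sum of the eigenspaces of `ad A` on `𝔨 = ℂ ⊗ 𝔨₀` for the
eigenvalues `i l` with `l ≥ 0`. -/
def q {𝔨₀ : Type*} [LieRing 𝔨₀] [LieAlgebra ℝ 𝔨₀] (A : 𝔨₀) :
    LieSubalgebra ℂ (ℂ ⊗[ℝ] 𝔨₀) :=
  nonnegEigen ((1 : ℂ) ⊗ₜ[ℝ] A)

/-- `Par(𝔳)`: the parabolic subalgebras `𝔮` of `𝔨` with `𝔳 ⊆ 𝔮` and `𝔫_r(𝔳) ∩ 𝔏(𝔮) = {0}`. -/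
def Par {𝔨₀ : Type*} [LieRing 𝔨₀] [LieAlgebra ℝ 𝔨₀]
    (𝔳 : LieSubalgebra ℂ (ℂ ⊗[ℝ] 𝔨₀)) : Set (LieSubalgebra ℂ (ℂ ⊗[ℝ] 𝔨₀)) :=
  {𝔮 | IsParabolic 𝔮 ∧ 𝔳 ≤ 𝔮 ∧ nilr 𝔳 ∩ leviPart 𝔮 = {0}}

/-! ### Lie groups -/

/-- A smooth real Lie group is a Lie group of the class which is needed for the Lie bracket on
`GroupLieAlgebra`. -/
instance lieGroupMinSmoothness {E : Type*} [NormedAddCommGroup E] [NormedSpace ℝ E]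
    {G : Type*} [TopologicalSpace G] [ChartedSpace E G] [Group G] [LieGroup 𝓘(ℝ, E) ∞ G] :
    LieGroup 𝓘(ℝ, E) (minSmoothness ℝ 3) G :=
  LieGroup.of_le (n := ∞) (by
    rw [minSmoothness_of_isRCLikeNormedField]
    exact WithTop.coe_le_coe.2 le_top)

/-- `Ad(g)`: the differential at the identity of `h ↦ g h g⁻¹`. -/
def Ad {E : Type*} [NormedAddCommGroup E] [NormedSpace ℝ E]
    {G : Type*} [TopologicalSpace G] [ChartedSpace E G] [Group G] (g : G) :
    GroupLieAlgebra 𝓘(ℝ, E) G →ₗ[ℝ] GroupLieAlgebra 𝓘(ℝ, E) G :=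
  (mfderiv 𝓘(ℝ, E) 𝓘(ℝ, E) (fun h : G => g * h * g⁻¹) (1 : G) : E →L[ℝ] E).toLinearMap

/-- The subalgebra `𝔮` of `𝔨 = ℂ ⊗ Lie(G)` satisfies `Ad_𝔨(g)(𝔮) = 𝔮`, where `Ad_𝔨(g)` is
the `ℂ`-linear extension of `Ad(g)`. -/
def AdStable {E : Type*} [NormedAddCommGroup E] [NormedSpace ℝ E] [CompleteSpace E]
    {G : Type*} [TopologicalSpace G] [ChartedSpace E G] [Group G] [LieGroup 𝓘(ℝ, E) ∞ G]
    (g : G) (𝔮 : LieSubalgebra ℂ (ℂ ⊗[ℝ] GroupLieAlgebra 𝓘(ℝ, E) G)) : Prop :=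
  Submodule.map ((Ad g).baseChange ℂ) 𝔮.toSubmodule = 𝔮.toSubmodule

/-- `Par(𝔳, M₀)`: the elements `𝔮` of `Par(𝔳)` with `Ad_𝔨(g)(𝔮) = 𝔮` for all `g ∈ M₀`. -/
def ParAdm {E : Type*} [NormedAddCommGroup E] [NormedSpace ℝ E] [CompleteSpace E]
    {G : Type*} [TopologicalSpace G] [ChartedSpace E G] [Group G] [LieGroup 𝓘(ℝ, E) ∞ G]
    (𝔳 : LieSubalgebra ℂ (ℂ ⊗[ℝ] GroupLieAlgebra 𝓘(ℝ, E) G)) (M₀ : Subgroup G) :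
    Set (LieSubalgebra ℂ (ℂ ⊗[ℝ] GroupLieAlgebra 𝓘(ℝ, E) G)) :=
  {𝔮 | 𝔮 ∈ Par 𝔳 ∧ ∀ g ∈ M₀, AdStable g 𝔮}

/-- `𝔞₀(M₀)`: the elements of `𝔨₀ = Lie(G)` fixed by `Ad(M₀)`. -/
def adFixed {E : Type*} [NormedAddCommGroup E] [NormedSpace ℝ E]
    {G : Type*} [TopologicalSpace G] [ChartedSpace E G] [Group G]
    (M₀ : Subgroup G) : Set (GroupLieAlgebra 𝓘(ℝ, E) G) :=
  {A | ∀ g ∈ M₀, Ad g A = A}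

end CRLie

end

/-!
Averaging over the compact group and correcting by the Killing form yields an `Ad`-invariant inner
product on the Lie algebra `𝔨₀` that agrees with the opposite of the Killing form up to the center.
It extends to a Hermitian product on `𝔨` for which `(ad X)* = -ad X̄`.

A parabolic subalgebra `𝔮` is its own normalizer and contains its orthogonal for the complexified
form; for a Borel subalgebra both follow from maximality and the theorems of Lie and Cartan. Let `P`
be the orthogonal projection onto such a `𝔮` and let `a` represent the functional
`Z ↦ tr (P ∘ ad Z)`. Then `ā = -a`, so `ad a` is self-adjoint, and for `X ∈ 𝔮` the number
`⟪X, [a, X]⟫` is the squared Hilbert–Schmidt norm of `P (ad X) (1 - P)`. Hence `ad a` is nonnegative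
on `𝔮`. An eigenvector orthogonal to `𝔮` with eigenvalue `l ≥ 0` has its conjugate in `𝔮`, with
eigenvalue `-l`, which forces `l = 0`; vanishing of the norm then puts the eigenvector itself in
`𝔮`. So `𝔮 = 𝔮_A` with `A = i a`. As `a` is canonically attached to `𝔮`, it is fixed by every
isometric automorphism that preserves `𝔮`, in particular by `Ad g` for `g ∈ M₀`.

Conversely, `𝔮_A` contains any Borel subalgebra `𝔟` that contains `A` and the positive eigenspaces:
if `[A, X] = i l X` with `X ∈ 𝔟` and `l < 0`, then `X̄ ∈ 𝔟`, and as the Killing form pairs the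
solvable algebra `𝔟` trivially with `[𝔟, 𝔟]`, it vanishes on `(X, X̄)`; thus `X` is central, so that
`l X = 0`.
-/

noncomputable section

namespace CRLie

section Projection

open LinearMap Module.End
open scoped InnerProductSpace ComplexOrder

section Trace

theorem trace_idempotent_mul_lie {R M : Type*} [CommRing R] [AddCommGroup M] [Module R M]
    {P A : Module.End R M} (hP : IsIdempotentElem P) (hA : P * A * P = A * P)
    (B : Module.End R M) :
    trace R M (P * ⁅A, B⁆) = trace R M (P * A * (1 - P) * ((1 - P) * B * P)) := by
  have hBA : trace R M (P * B * A) = trace R M (A * P * B) := by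
    rw [trace_mul_comm, ← mul_assoc]
  calc trace R M (P * ⁅A, B⁆)
      = trace R M (P * A * B - P * A * P * B) := by
        rw [Ring.lie_def, mul_sub, map_sub, ← mul_assoc, ← mul_assoc, hBA, ← hA, ← map_sub]
    _ = trace R M (P * (P * A * (1 - P) * B)) := by
        congr 1
        simp only [mul_sub, sub_mul, mul_one, ← mul_assoc, hP.eq]
    _ = trace R M (P * A * (1 - P) * B * P) := trace_mul_comm _ _ _
    _ = trace R M (P * A * (1 - P) * ((1 - P) * B * P)) := by
        congr 1
        simp only [← mul_assoc]
        rw [mul_assoc (P * A) (1 - P) (1 - P), hP.one_sub.eq]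

variable {𝕜 V : Type*} [RCLike 𝕜] [NormedAddCommGroup V] [InnerProductSpace 𝕜 V]
  [FiniteDimensional 𝕜 V]

theorem trace_adjoint (T : V →ₗ[𝕜] V) :
    trace 𝕜 V (adjoint T) = starRingEnd 𝕜 (trace 𝕜 V T) := by
  simp [trace_eq_sum_inner _ (stdOrthonormalBasis 𝕜 V), adjoint_inner_right]

theorem trace_mul_adjoint_self_eq_zero_iff {T : V →ₗ[𝕜] V} :
    trace 𝕜 V (T * adjoint T) = 0 ↔ T = 0 := by
  let b := stdOrthonormalBasis 𝕜 V
  have hsum : trace 𝕜 V (T * adjoint T) = ((∑ i, ‖adjoint T (b i)‖ ^ 2 : ℝ) : 𝕜) := by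
    simp [trace_eq_sum_inner _ b, ← adjoint_inner_left, inner_self_eq_norm_sq_to_K]
  refine ⟨fun h => ?_, fun h => by simp [h]⟩
  rw [hsum, RCLike.ofReal_eq_zero, Finset.sum_eq_zero_iff_of_nonneg fun _ _ => sq_nonneg _] at h
  have hadj : adjoint T = 0 := b.toBasis.ext fun i => by simpa using h i (Finset.mem_univ i)
  rw [← adjoint_adjoint T, hadj, map_zero]

theorem adjoint_starProjection (S : Submodule 𝕜 V) :
    adjoint (S.starProjection : V →ₗ[𝕜] V) = S.starProjection :=
  S.starProjection_isSymmetric.adjoint_eq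

theorem starProjection_mul_mul_self {S : Submodule 𝕜 V} {T : Module.End 𝕜 V}
    (hT : S ∈ T.invtSubmodule) :
    (S.starProjection : Module.End 𝕜 V) * T * S.starProjection = T * S.starProjection := by
  ext x
  exact Submodule.starProjection_eq_self_iff.mpr (hT (S.starProjection_apply_mem x))

theorem trace_starProjection_mul_lie_adjoint {S : Submodule 𝕜 V} {T : Module.End 𝕜 V}
    (hT : S ∈ T.invtSubmodule) :
    letI P : Module.End 𝕜 V := S.starProjection
    trace 𝕜 V (P * ⁅T, adjoint T⁆) =
      trace 𝕜 V (P * T * (1 - P) * adjoint (P * T * (1 - P))) := by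
  rw [trace_idempotent_mul_lie (ContinuousLinearMap.IsIdempotentElem.toLinearMap
      S.isIdempotentElem_starProjection)
    (starProjection_mul_mul_self hT)]
  simp only [mul_eq_comp, adjoint_comp, map_sub, adjoint_starProjection, one_eq_id, adjoint_id,
    comp_assoc]

theorem trace_starProjection_mul_lie {S : Submodule 𝕜 V} {A B : Module.End 𝕜 V}
    (hA : S ∈ A.invtSubmodule) (hB : S ∈ B.invtSubmodule) :
    trace 𝕜 V ((S.starProjection : Module.End 𝕜 V) * ⁅A, B⁆) = 0 := by
  rw [trace_idempotent_mul_lie (ContinuousLinearMap.IsIdempotentElem.toLinearMap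
      S.isIdempotentElem_starProjection)
    (starProjection_mul_mul_self hA), sub_mul, sub_mul, one_mul, starProjection_mul_mul_self hB,
    sub_self, mul_zero, map_zero]

theorem le_of_forall_eigenvector {T : V →ₗ[𝕜] V} (hT : T.IsSymmetric) {S S' : Submodule 𝕜 V}
    (hS : S ∈ invtSubmodule T) (h : ∀ μ : ℝ, ∀ x ∈ S, T x = (μ : 𝕜) • x → x ∈ S') : S ≤ S' := by
  have htop : ⨆ μ, eigenspace T μ = ⊤ :=
    Submodule.orthogonal_eq_bot_iff.mp hT.orthogonalComplement_iSup_eigenspaces_eq_bot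
  rw [Submodule.eq_iSup_inf_genEigenspace 1 hS htop]
  refine iSup_le fun μ x ⟨hxS, hx⟩ => ?_
  obtain rfl | hx0 := eq_or_ne x 0
  · exact zero_mem S'
  obtain ⟨r, rfl⟩ := RCLike.conj_eq_iff_real.mp
    (hT.conj_eigenvalue_eq_self (hasEigenvalue_of_hasEigenvector ⟨hx, hx0⟩))
  exact h r x hxS (mem_eigenspace_iff.mp hx)

end Trace

section CompactBracket

variable {V : Type*} [NormedAddCommGroup V] [InnerProductSpace ℂ V]

/-- A Lie bracket `ad` with a conjugation `σ` and an inner product for which `ad x` has adjoint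
`-ad (σ x)`: the structure of the complexification of a compact Lie algebra. The bracket is a bare
bilinear map because `LieRing V` and `NormedAddCommGroup V` would endow `V` with two additions. -/
structure IsCompactBracket (ad : V →ₗ[ℂ] Module.End ℂ V) (σ : V →ₗ⋆[ℂ] V) : Prop where
  skew : ∀ x y, ad x y = -ad y x
  jacobi : ∀ x y, ad (ad x y) = ⁅ad x, ad y⁆
  conj_conj : ∀ x, σ (σ x) = x
  conj_inner : ∀ x y, ⟪σ x, σ y⟫_ℂ = ⟪y, x⟫_ℂ
  conj_bracket : ∀ x y, σ (ad x y) = ad (σ x) (σ y)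
  inner_bracket : ∀ x y z, ⟪ad x y, z⟫_ℂ = -⟪y, ad (σ x) z⟫_ℂ

section TraceVector

variable [FiniteDimensional ℂ V]

/-- The vector representing the functional `z ↦ tr (P ∘ ad z)`, where `P` is the orthogonal
projection onto `S`. For a parabolic subalgebra `S` it is the canonical element whose nonnegative
eigenspaces span `S`. -/
def traceVector (ad : V →ₗ[ℂ] Module.End ℂ V) (S : Submodule ℂ V) : V :=
  (InnerProductSpace.toDual ℂ V).symm
    (trace ℂ V ∘ₗ mulLeft ℂ (S.starProjection : Module.End ℂ V) ∘ₗ ad).toContinuousLinearMap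

theorem inner_traceVector (ad : V →ₗ[ℂ] Module.End ℂ V) (S : Submodule ℂ V) (z : V) :
    ⟪traceVector ad S, z⟫_ℂ = trace ℂ V ((S.starProjection : Module.End ℂ V) * ad z) := by
  simp [traceVector]

theorem map_traceVector {ad : V →ₗ[ℂ] Module.End ℂ V} {S : Submodule ℂ V} (u : V ≃ₗᵢ[ℂ] V)
    (hu : ∀ x y, u (ad x y) = ad (u x) (u y)) (hS : S.map (u.toLinearEquiv : V →ₗ[ℂ] V) = S) :
    u (traceVector ad S) = traceVector ad S := by
  refine ext_inner_right ℂ fun z => ?_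
  obtain ⟨z, rfl⟩ := u.surjective z
  have hP (x : V) : S.starProjection (u x) = u (S.starProjection x) := by
    simpa [hS] using Submodule.starProjection_map_apply u S (u x)
  have hconj : (S.starProjection : Module.End ℂ V) * ad (u z) =
      u.toLinearEquiv.conj (S.starProjection * ad z) := by
    ext x
    obtain ⟨x, rfl⟩ := u.surjective x
    simp [LinearEquiv.conj_apply, ← hu, hP]
  rw [u.inner_map_map, inner_traceVector, inner_traceVector, hconj, trace_conj']

end TraceVector

namespace IsCompactBracket

variable {ad : V →ₗ[ℂ] Module.End ℂ V} {σ : V →ₗ⋆[ℂ] V} (h : IsCompactBracket ad σ)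
include h

theorem inner_conj_left (x y : V) : ⟪σ x, y⟫_ℂ = ⟪σ y, x⟫_ℂ := by
  rw [← h.conj_inner, h.conj_conj]

theorem isSymmetric_ad {a : V} (ha : σ a = -a) : (ad a).IsSymmetric := fun x y => by
  rw [h.inner_bracket, ha, map_neg, LinearMap.neg_apply, inner_neg_right, neg_neg]

variable [FiniteDimensional ℂ V]

theorem adjoint_ad (x : V) : adjoint (ad x) = -ad (σ x) := by
  ext y
  refine ext_inner_left ℂ fun z => ?_
  rw [adjoint_inner_right, h.inner_bracket, LinearMap.neg_apply, inner_neg_right]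

theorem conj_traceVector (S : Submodule ℂ V) : σ (traceVector ad S) = -traceVector ad S := by
  refine ext_inner_right ℂ fun z => ?_
  have hz : ad (σ z) = -adjoint (ad z) := by rw [h.adjoint_ad, neg_neg]
  rw [h.inner_conj_left, ← inner_conj_symm, inner_traceVector, inner_neg_left, inner_traceVector,
    ← trace_adjoint, hz, mul_neg, map_neg, map_neg, mul_eq_comp, adjoint_comp, adjoint_adjoint,
    adjoint_starProjection, ← mul_eq_comp, trace_mul_comm]

theorem inner_ad_traceVector {S : Submodule ℂ V} {x : V} (hx : S ∈ (ad x).invtSubmodule) :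
    letI R : Module.End ℂ V := S.starProjection * ad x * (1 - S.starProjection)
    ⟪x, ad (traceVector ad S) x⟫_ℂ = trace ℂ V (R * adjoint R) := by
  have hbracket : ad (ad (σ x) x) = ⁅ad x, adjoint (ad x)⁆ := by
    rw [h.jacobi, h.adjoint_ad, Ring.lie_def, Ring.lie_def, mul_neg, neg_mul, neg_sub_neg]
  rw [← trace_starProjection_mul_lie_adjoint hx, ← hbracket, ← inner_traceVector,
    ← h.isSymmetric_ad (h.conj_traceVector S), h.skew, inner_neg_left, h.inner_bracket, neg_neg]

theorem eigenvalue_traceVector_nonneg {S : Submodule ℂ V} {x : V}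
    (hx : S ∈ (ad x).invtSubmodule) (hx0 : x ≠ 0) {μ : ℝ}
    (hμ : ad (traceVector ad S) x = (μ : ℂ) • x) : 0 ≤ μ := by
  have hinner := h.inner_ad_traceVector hx
  rw [hμ, inner_smul_right, inner_self_eq_norm_sq_to_K] at hinner
  have hnonneg := (isPositive_self_comp_adjoint (S.starProjection * ad x *
    (1 - S.starProjection) : Module.End ℂ V)).trace_nonneg
  rw [← mul_eq_comp, ← hinner] at hnonneg
  have hprod : ((0 : ℝ) : ℂ) ≤ ((μ * ‖x‖ ^ 2 : ℝ) : ℂ) := by simpa using hnonneg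
  exact nonneg_of_mul_nonneg_left (Complex.real_le_real.mp hprod) (by positivity)

/-- The operator `P (ad x) (1 - P)` has Hilbert–Schmidt norm zero, hence `(ad x)* = -ad (σ x)`
stabilizes `S` along with `ad x`. -/
theorem mem_invtSubmodule_ad_conj_of_ad_traceVector_eq_zero {S : Submodule ℂ V} {x : V}
    (hx : S ∈ (ad x).invtSubmodule) (hx0 : ad (traceVector ad S) x = 0) :
    S ∈ (ad (σ x)).invtSubmodule := by
  have htrace := h.inner_ad_traceVector hx
  rw [hx0, inner_zero_right, eq_comm, trace_mul_adjoint_self_eq_zero_iff] at htrace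
  have horth : Sᗮ ∈ (ad x).invtSubmodule := fun w hw => by
    simpa [S.starProjection_apply_eq_zero_iff.mpr hw, S.starProjection_apply_eq_zero_iff] using
      LinearMap.congr_fun htrace w
  intro y hy
  have hy' := mem_invtSubmodule_adjoint_iff.mpr horth hy
  rw [h.adjoint_ad] at hy'
  exact neg_mem_iff (H := S).mp hy'

section SelfNormalizing

variable {S : Submodule ℂ V} (hnorm : ∀ x, S ∈ (ad x).invtSubmodule ↔ x ∈ S)
  (hperp : ∀ x, (∀ y ∈ S, ⟪σ y, x⟫_ℂ = 0) → x ∈ S)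
include hnorm hperp

theorem traceVector_mem : traceVector ad S ∈ S := by
  refine (hnorm _).mp fun y hy => hperp _ fun w hw => ?_
  rw [h.skew, inner_neg_right, ← h.conj_conj y, ← neg_eq_iff_eq_neg.mpr (h.inner_bracket _ _ _),
    neg_neg, ← h.conj_bracket, h.inner_conj_left, h.conj_traceVector, inner_neg_left,
    inner_traceVector, h.jacobi,
    trace_starProjection_mul_lie ((hnorm y).mpr hy) ((hnorm w).mpr hw), neg_zero]

theorem eq_zero_of_mem_orthogonal_of_ad_traceVector_eq_smul {x : V} (hx : x ∈ Sᗮ) {l : ℝ}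
    (hl : 0 ≤ l) (hxl : ad (traceVector ad S) x = (l : ℂ) • x) : x = 0 := by
  have hσx : σ x ∈ S := hperp _ fun u hu => by
    rw [h.conj_inner]
    exact Submodule.inner_left_of_mem_orthogonal hu hx
  have heigen : ad (traceVector ad S) (σ x) = ((-l : ℝ) : ℂ) • σ x := by
    rw [← neg_neg (traceVector ad S), ← h.conj_traceVector, map_neg, LinearMap.neg_apply,
      ← h.conj_bracket, hxl, map_smulₛₗ, Complex.conj_ofReal, Complex.ofReal_neg, neg_smul]
  by_contra hx0
  have hσx0 : σ x ≠ 0 := fun h0 => hx0 (by rw [← h.conj_conj x, h0, map_zero])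
  have hl0 : l = 0 := hl.antisymm'
    (by simpa using h.eigenvalue_traceVector_nonneg ((hnorm _).mpr hσx) hσx0 heigen)
  have hxS : x ∈ S := by
    rw [hl0, neg_zero, Complex.ofReal_zero, zero_smul] at heigen
    rw [← hnorm, ← h.conj_conj x]
    exact h.mem_invtSubmodule_ad_conj_of_ad_traceVector_eq_zero ((hnorm _).mpr hσx) heigen
  exact hx0 (inner_self_eq_zero.mp (Submodule.inner_right_of_mem_orthogonal hxS hx))

theorem eq_iSup_eigenspace_traceVector :
    S = ⨆ l : {x : ℝ // 0 ≤ x}, eigenspace (ad (traceVector ad S)) ((l : ℝ) : ℂ) := by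
  have hsymm := h.isSymmetric_ad (h.conj_traceVector S)
  have hinv := (hnorm _).mpr (h.traceVector_mem hnorm hperp)
  apply le_antisymm
  · refine le_of_forall_eigenvector hsymm hinv fun μ x hx hμ => ?_
    obtain rfl | hx0 := eq_or_ne x 0
    · exact zero_mem _
    exact Submodule.mem_iSup_of_mem
      ⟨μ, h.eigenvalue_traceVector_nonneg ((hnorm x).mpr hx) hx0 hμ⟩ (mem_eigenspace_iff.mpr hμ)
  · refine iSup_le fun l x hx => ?_
    have hcomm : Commute (S.starProjection : Module.End ℂ V) (ad (traceVector ad S)) := by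
      rw [LinearMap.IsIdempotentElem.commute_iff
        (ContinuousLinearMap.IsIdempotentElem.toLinearMap S.isIdempotentElem_starProjection)]
      simpa using ⟨hinv, hsymm.orthogonalComplement_mem_invtSubmodule hinv⟩
    have hx' : ad (traceVector ad S) (x - S.starProjection x) =
        ((l : ℝ) : ℂ) • (x - S.starProjection x) := by
      have := LinearMap.congr_fun hcomm.eq x
      simp only [Module.End.mul_apply, ContinuousLinearMap.coe_coe] at this
      rw [map_sub, ← this, mem_eigenspace_iff.mp hx, map_smul, smul_sub]
    rw [sub_eq_zero.mp (h.eq_zero_of_mem_orthogonal_of_ad_traceVector_eq_smul hnorm hperp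
      (S.sub_starProjection_mem_orthogonal x) l.2 hx')]
    exact S.starProjection_apply_mem x

end SelfNormalizing

end IsCompactBracket

end CompactBracket

end Projection

section Solvable

open LieAlgebra LieModule

section CommRing

variable {R L : Type*} [CommRing R] [LieRing L] [LieAlgebra R L]

theorem isSolvable_of_derivedSeries_one (h : LieAlgebra.IsSolvable (derivedSeries R L 1)) :
    LieAlgebra.IsSolvable L := by
  obtain ⟨k, hk⟩ := IsSolvable.solvable R (derivedSeries R L 1)
  rw [LieIdeal.derivedSeries_eq_bot_iff, ← derivedSeriesOfIdeal_add] at hk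
  exact IsSolvable.mk hk

theorem derivedSeries_one_le {p : Submodule R L} (hp : ∀ x y : L, ⁅x, y⁆ ∈ p) :
    (derivedSeries R L 1).toSubmodule ≤ p := by
  rw [← LieIdeal.toLieSubalgebra_toSubmodule, coe_derivedSeries_one_eq, Submodule.span_le]
  rintro _ ⟨x, y, rfl⟩
  exact hp x y

theorem isSolvable_of_lie_mem {𝔰 𝔱 : LieSubalgebra R L} (h𝔰 : LieAlgebra.IsSolvable 𝔰)
    (h : ∀ x ∈ 𝔱, ∀ y ∈ 𝔱, ⁅x, y⁆ ∈ 𝔰) : LieAlgebra.IsSolvable 𝔱 := by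
  have hle : (derivedSeries R 𝔱 1).toSubmodule ≤ 𝔰.toSubmodule.comap 𝔱.toSubmodule.subtype :=
    derivedSeries_one_le fun x y => h x x.2 y y.2
  let f : derivedSeries R 𝔱 1 →ₗ⁅R⁆ 𝔰 :=
    { toFun := fun x => ⟨x.1.1, hle x.2⟩
      map_add' := fun _ _ => rfl
      map_smul' := fun _ _ => rfl
      map_lie' := rfl }
  refine isSolvable_of_derivedSeries_one (R := R)
    (Function.Injective.lieAlgebra_isSolvable (f := f) fun x y hxy => ?_)
  exact Subtype.ext (Subtype.ext (congrArg (fun z : 𝔰 => (z : L)) hxy))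

theorem isNilpotent_of_isNilpotent_mapQ {M : Type*} [AddCommGroup M] [Module R M]
    {T : Module.End R M} {N : Submodule R M} (hN : N ≤ N.comap T)
    (hT : IsNilpotent (N.mapQ N T hN)) (hTN : N ≤ LinearMap.ker T) : IsNilpotent T := by
  obtain ⟨k, hk⟩ := hT
  refine ⟨k + 1, LinearMap.ext fun v => ?_⟩
  have hmem : (T ^ k) v ∈ N := by
    rw [← Submodule.mapQ_pow] at hk
    exact (Submodule.Quotient.mk_eq_zero N).mp (LinearMap.congr_fun hk (N.mkQ v))
  rw [pow_succ', Module.End.mul_apply, LinearMap.mem_ker.mp (hTN hmem), LinearMap.zero_apply]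

theorem lie_lie_eq_zero_of_mem_weightSpace {M : Type*} [AddCommGroup M] [Module R M]
    [LieRingModule L M] [LieModule R L M] {χ : L → R} {v : M} (hv : v ∈ weightSpace M χ)
    (x y : L) : ⁅⁅x, y⁆, v⁆ = 0 := by
  rw [mem_weightSpace] at hv
  rw [lie_lie, hv, hv, lie_smul, lie_smul, hv, hv, smul_comm, sub_self]

end CommRing

section LieTheorem

variable {k L M : Type*} [Field k] [IsAlgClosed k] [CharZero k] [LieRing L] [LieAlgebra k L]
  [LieAlgebra.IsSolvable L] [AddCommGroup M] [Module k M] [LieRingModule L M] [LieModule k L M]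
  [FiniteDimensional k M]

theorem isNilpotent_toEnd_mul_toEnd_lie (x y z : L) :
    IsNilpotent (toEnd k L M z * toEnd k L M ⁅x, y⁆) := by
  induction hn : Module.finrank k M using Nat.strong_induction_on generalizing M with
  | _ n ih
  subst hn
  rcases subsingleton_or_nontrivial M with _ | _
  · exact ⟨1, Subsingleton.elim _ _⟩
  obtain ⟨χ, _⟩ := exists_nontrivial_weightSpace_of_isSolvable k L M
  have hlt : Module.finrank k (M ⧸ weightSpace M χ) < Module.finrank k M := by
    have hpos : 0 < Module.finrank k (weightSpace M χ) := Module.finrank_pos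
    have hadd := (weightSpace M χ).toSubmodule.finrank_quotient_add_finrank
    change Module.finrank k (M ⧸ weightSpace M χ) + Module.finrank k (weightSpace M χ) = _ at hadd
    lia
  refine isNilpotent_of_isNilpotent_mapQ (N := (weightSpace M χ).toSubmodule)
    (fun v hv => LieSubmodule.lie_mem _ (LieSubmodule.lie_mem _ hv)) ?_ fun v hv => ?_
  · have hmapQ : (weightSpace M χ).toSubmodule.mapQ _ (toEnd k L M z * toEnd k L M ⁅x, y⁆)
        (fun v hv => LieSubmodule.lie_mem _ (LieSubmodule.lie_mem _ hv)) =
        toEnd k L (M ⧸ weightSpace M χ) z * toEnd k L (M ⧸ weightSpace M χ) ⁅x, y⁆ :=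
      Submodule.linearMap_qext _ rfl
    rw [hmapQ]
    exact ih _ hlt rfl
  · change ⁅z, ⁅⁅x, y⁆, v⁆⁆ = 0
    rw [lie_lie_eq_zero_of_mem_weightSpace hv, lie_zero]

/-- Lie's theorem for the image of `P` in `M ⧸ N`. -/
theorem exists_eigenvector_mod {N P : LieSubmodule k L M} (hPN : ¬P ≤ N) :
    ∃ χ : L → k, ∃ v ∈ P, v ∉ N ∧ ∀ x : L, ⁅x, v⁆ - χ x • v ∈ N := by
  obtain ⟨v₀, hv₀P, hv₀N⟩ := SetLike.not_le_iff_exists.mp hPN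
  let W : LieSubmodule k L (M ⧸ N) := P.map (LieSubmodule.Quotient.mk' N)
  have : Nontrivial W := by
    refine nontrivial_of_ne ⟨_, LieSubmodule.mem_map_of_mem hv₀P⟩ 0 fun h0 => hv₀N ?_
    exact LieSubmodule.Quotient.mk_eq_zero'.mp (congrArg Subtype.val h0)
  obtain ⟨χ, _⟩ := exists_nontrivial_weightSpace_of_isSolvable k L W
  obtain ⟨⟨⟨w, hw⟩, hwχ⟩, hw0⟩ := exists_ne (0 : weightSpace W χ)
  obtain ⟨v, hvP, rfl⟩ := (LieSubmodule.mem_map w).mp hw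
  rw [mem_weightSpace] at hwχ
  refine ⟨χ, v, hvP, fun hvN => hw0 ?_, fun x => ?_⟩
  · exact Subtype.ext (Subtype.ext (LieSubmodule.Quotient.mk_eq_zero'.mpr hvN))
  · exact (Submodule.Quotient.eq _).mp (congrArg Subtype.val (hwχ x))

end LieTheorem

section KillingForm

variable {k L : Type*} [Field k] [CharZero k] [LieRing L] [LieAlgebra k L] [FiniteDimensional k L]
  {𝔰 : LieSubalgebra k L}

theorem killingForm_lie_eq_zero_of_isSolvable [IsAlgClosed k] [LieAlgebra.IsSolvable 𝔰]
    {x y z : L} (hx : x ∈ 𝔰) (hy : y ∈ 𝔰) (hz : z ∈ 𝔰) : killingForm k L z ⁅x, y⁆ = 0 :=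
  (LinearMap.isNilpotent_trace_of_isNilpotent
    (isNilpotent_toEnd_mul_toEnd_lie (M := L) (⟨x, hx⟩ : 𝔰) ⟨y, hy⟩ ⟨z, hz⟩)).eq_zero

theorem isSolvable_of_killingForm_lie_eq_zero
    (h : ∀ x ∈ 𝔰, ∀ y ∈ 𝔰, ∀ z ∈ 𝔰, killingForm k L z ⁅x, y⁆ = 0) : LieAlgebra.IsSolvable 𝔰 := by
  let D := derivedSeries k 𝔰 1
  have htrace : traceForm k D L = 0 := by
    ext ⟨x, hx⟩ ⟨y, hy⟩
    exact derivedSeries_one_le (L := 𝔰) (p := (LinearMap.ker (killingForm k L x)).comap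
      𝔰.toSubmodule.subtype) (fun a b => h a a.2 b b.2 x x.2) hy
  have := isNilpotent_derivedSeries_of_traceForm_eq_zero htrace
  let incl : derivedSeries k D 1 →ₗ[k] L :=
    𝔰.toSubmodule.subtype ∘ₗ D.toSubmodule.subtype ∘ₗ (derivedSeries k D 1).toSubmodule.subtype
  have hincl : Function.Injective incl :=
    Subtype.val_injective.comp (Subtype.val_injective.comp Subtype.val_injective)
  have : LieRing.IsNilpotent (derivedSeries k D 1) :=
    Function.Injective.lieModuleIsNilpotent (R := k) (f := LieHom.id) (g := incl)
      (fun _ _ => rfl) hincl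
  have : LieAlgebra.IsSolvable D := isSolvable_of_derivedSeries_one (R := k) inferInstance
  exact isSolvable_of_derivedSeries_one (R := k) this

end KillingForm

section Adjoin

variable {R L : Type*} [CommRing R] [LieRing L] [LieAlgebra R L]

theorem lie_add_smul_add_smul (b b' x : L) (c c' : R) :
    ⁅b + c • x, b' + c' • x⁆ = ⁅b, b'⁆ + (c' • ⁅b, x⁆ - c • ⁅b', x⁆) := by
  simp only [add_lie, lie_add, smul_lie, lie_smul, lie_self, ← lie_skew x b']
  module

/-- The subalgebra `𝔟 + R x`, for an element `x` that spans a `𝔟`-stable line modulo `𝔟`. -/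
def adjoin (𝔟 : LieSubalgebra R L) (x : L)
    (hx : ∀ b ∈ 𝔟, ⁅b, x⁆ ∈ 𝔟.toSubmodule ⊔ Submodule.span R {x}) : LieSubalgebra R L :=
  { 𝔟.toSubmodule ⊔ Submodule.span R {x} with
    lie_mem' := by
      intro u v hu hv
      obtain ⟨b, hb, _, hc, rfl⟩ := Submodule.mem_sup.mp hu
      obtain ⟨b', hb', _, hc', rfl⟩ := Submodule.mem_sup.mp hv
      obtain ⟨c, rfl⟩ := Submodule.mem_span_singleton.mp hc
      obtain ⟨c', rfl⟩ := Submodule.mem_span_singleton.mp hc'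
      rw [lie_add_smul_add_smul]
      exact add_mem (Submodule.mem_sup_left (𝔟.lie_mem hb hb'))
        (sub_mem (Submodule.smul_mem _ c' (hx b hb)) (Submodule.smul_mem _ c (hx b' hb'))) }

theorem le_adjoin {𝔟 : LieSubalgebra R L} {x : L}
    (hx : ∀ b ∈ 𝔟, ⁅b, x⁆ ∈ 𝔟.toSubmodule ⊔ Submodule.span R {x}) : 𝔟 ≤ adjoin 𝔟 x hx :=
  fun _ hb => Submodule.mem_sup_left hb

theorem self_mem_adjoin {𝔟 : LieSubalgebra R L} {x : L}
    (hx : ∀ b ∈ 𝔟, ⁅b, x⁆ ∈ 𝔟.toSubmodule ⊔ Submodule.span R {x}) : x ∈ adjoin 𝔟 x hx :=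
  Submodule.mem_sup_right (Submodule.mem_span_singleton_self x)

theorem mem_adjoin {𝔟 : LieSubalgebra R L} {x : L}
    {hx : ∀ b ∈ 𝔟, ⁅b, x⁆ ∈ 𝔟.toSubmodule ⊔ Submodule.span R {x}} {y : L} :
    y ∈ adjoin 𝔟 x hx ↔ ∃ b ∈ 𝔟, ∃ c : R, b + c • x = y := by
  change y ∈ 𝔟.toSubmodule ⊔ Submodule.span R {x} ↔ _
  simp [Submodule.mem_sup, Submodule.mem_span_singleton]

theorem isSolvable_adjoin_of_mem_normalizer {𝔟 : LieSubalgebra R L}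
    (h𝔟 : LieAlgebra.IsSolvable 𝔟) {x : L} (hx : ∀ b ∈ 𝔟, ⁅b, x⁆ ∈ 𝔟) :
    LieAlgebra.IsSolvable (adjoin 𝔟 x fun b hb => Submodule.mem_sup_left (hx b hb)) := by
  refine isSolvable_of_lie_mem h𝔟 fun u hu v hv => ?_
  obtain ⟨b, hb, c, rfl⟩ := mem_adjoin.mp hu
  obtain ⟨b', hb', c', rfl⟩ := mem_adjoin.mp hv
  rw [lie_add_smul_add_smul]
  exact add_mem (𝔟.lie_mem hb hb')
    (sub_mem (𝔟.smul_mem c' (hx b hb)) (𝔟.smul_mem c (hx b' hb')))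

end Adjoin

theorem isSolvable_adjoin_of_killingForm_eq_zero {k L : Type*} [Field k] [IsAlgClosed k]
    [CharZero k] [LieRing L] [LieAlgebra k L] [FiniteDimensional k L] {𝔟 : LieSubalgebra k L}
    (h𝔟 : LieAlgebra.IsSolvable 𝔟) {x : L}
    {hx : ∀ b ∈ 𝔟, ⁅b, x⁆ ∈ 𝔟.toSubmodule ⊔ Submodule.span k {x}}
    (horth : ∀ b ∈ 𝔟, killingForm k L b x = 0) (hself : killingForm k L x x = 0) :
    LieAlgebra.IsSolvable (adjoin 𝔟 x hx) := by
  have hperp : ∀ t ∈ adjoin 𝔟 x hx, killingForm k L t x = 0 := by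
    intro t ht
    obtain ⟨b, hb, c, rfl⟩ := mem_adjoin.mp ht
    simp [horth b hb, hself]
  have hlie_right : ∀ t ∈ adjoin 𝔟 x hx, ∀ u ∈ adjoin 𝔟 x hx, killingForm k L t ⁅u, x⁆ = 0 :=
    fun t ht u hu => (traceForm_apply_lie_apply k L L t u x).symm.trans
      (hperp _ (LieSubalgebra.lie_mem _ ht hu))
  have hlie : ∀ t ∈ adjoin 𝔟 x hx, ∀ b ∈ 𝔟, ∀ b' ∈ 𝔟, killingForm k L t ⁅b, b'⁆ = 0 := by
    intro t ht b hb b' hb'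
    obtain ⟨b₀, hb₀, c, rfl⟩ := mem_adjoin.mp ht
    have hxlie : killingForm k L x ⁅b, b'⁆ = 0 :=
      (traceForm_comm k L L _ _).trans (horth _ (𝔟.lie_mem hb hb'))
    simp [killingForm_lie_eq_zero_of_isSolvable hb hb' hb₀, hxlie]
  refine isSolvable_of_killingForm_lie_eq_zero fun u hu v hv t ht => ?_
  obtain ⟨b, hb, c, rfl⟩ := mem_adjoin.mp hu
  obtain ⟨b', hb', c', rfl⟩ := mem_adjoin.mp hv
  simp only [lie_add_smul_add_smul, map_add, map_sub, map_smul, hlie t ht b hb b' hb',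
    hlie_right t ht b (le_adjoin hx hb), hlie_right t ht b' (le_adjoin hx hb'), smul_zero,
    sub_zero, add_zero]

section Borel

variable {𝔨 : Type*} [LieRing 𝔨] [LieAlgebra ℂ 𝔨]

theorem exists_isBorel_ge [FiniteDimensional ℂ 𝔨] {𝔰 : LieSubalgebra ℂ 𝔨}
    (h𝔰 : LieAlgebra.IsSolvable 𝔰) : ∃ 𝔟, IsBorel 𝔟 ∧ 𝔰 ≤ 𝔟 := by
  obtain ⟨𝔟, hle, hmax⟩ := exists_maximal_ge_of_wellFoundedGT
    (fun 𝔰 : LieSubalgebra ℂ 𝔨 => LieAlgebra.IsSolvable 𝔰) 𝔰 h𝔰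
  exact ⟨𝔟, hmax, hle⟩

namespace IsBorel

variable {𝔟 : LieSubalgebra ℂ 𝔨} (h : IsBorel 𝔟)
include h

theorem mem_of_isSolvable_adjoin {x : 𝔨}
    {hx : ∀ b ∈ 𝔟, ⁅b, x⁆ ∈ 𝔟.toSubmodule ⊔ Submodule.span ℂ {x}}
    (hs : LieAlgebra.IsSolvable (adjoin 𝔟 x hx)) : x ∈ 𝔟 :=
  h.le_of_ge hs (le_adjoin hx) (self_mem_adjoin hx)

theorem mem_of_lie_mem {x : 𝔨} (hx : ∀ b ∈ 𝔟, ⁅b, x⁆ ∈ 𝔟) : x ∈ 𝔟 :=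
  h.mem_of_isSolvable_adjoin (isSolvable_adjoin_of_mem_normalizer h.prop hx)

theorem mem_of_killingForm_eq_zero [FiniteDimensional ℂ 𝔨] {x : 𝔨}
    (hx : ∀ b ∈ 𝔟, killingForm ℂ 𝔨 b x = 0) : x ∈ 𝔟 := by
  by_contra hxb
  have := h.prop
  let orth : LieSubmodule ℂ 𝔟 𝔨 := LieAlgebra.InvariantForm.orthogonal (killingForm ℂ 𝔨)
    (fun b => traceForm_lieInvariant ℂ 𝔨 𝔨 b) 𝔟.toLieSubmodule
  obtain ⟨χ, z, hz, hzb, hχ⟩ := exists_eigenvector_mod (N := 𝔟.toLieSubmodule) (P := orth)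
    (SetLike.not_le_iff_exists.mpr ⟨x, hx, hxb⟩)
  replace hz : ∀ b ∈ 𝔟, killingForm ℂ 𝔨 b z = 0 := hz
  replace hχ : ∀ b : 𝔟, ⁅(b : 𝔨), z⁆ - χ b • z ∈ 𝔟 := hχ
  have hline : ∀ b ∈ 𝔟, ⁅b, z⁆ ∈ 𝔟.toSubmodule ⊔ Submodule.span ℂ {z} := fun b hb =>
    Submodule.mem_sup.mpr ⟨_, hχ ⟨b, hb⟩, _,
      Submodule.smul_mem _ _ (Submodule.mem_span_singleton_self z), sub_add_cancel _ _⟩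
  refine hzb ?_
  by_cases hzz : killingForm ℂ 𝔨 z z = 0
  · exact h.mem_of_isSolvable_adjoin (hx := hline)
      (isSolvable_adjoin_of_killingForm_eq_zero h.prop hz hzz)
  · refine h.mem_of_lie_mem fun b hb => ?_
    have hbz : killingForm ℂ 𝔨 ⁅b, z⁆ z = 0 :=
      (traceForm_apply_lie_apply ℂ 𝔨 𝔨 b z z).trans (by rw [lie_self, map_zero])
    have hχb : χ ⟨b, hb⟩ * killingForm ℂ 𝔨 z z = 0 := by
      simpa [hbz] using hz _ (hχ ⟨b, hb⟩)
    simpa [(mul_eq_zero.mp hχb).resolve_right hzz] using hχ ⟨b, hb⟩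

end IsBorel

end Borel

end Solvable

section PosEigen

theorem killingForm_eq_zero_of_lie_eq_smul {k L : Type*} [Field k] [LieRing L] [LieAlgebra k L]
    {a x y : L} {c d : k} (hx : ⁅a, x⁆ = c • x) (hy : ⁅a, y⁆ = d • y) (hcd : c + d ≠ 0) :
    killingForm k L x y = 0 := by
  have hinv : killingForm k L ⁅a, x⁆ y = -killingForm k L x ⁅a, y⁆ :=
    LieModule.traceForm_lieInvariant k L L a x y
  rw [hx, hy, map_smul, map_smul, LinearMap.smul_apply, smul_eq_mul, smul_eq_mul,
    eq_neg_iff_add_eq_zero, ← add_mul] at hinv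
  exact (mul_eq_zero.mp hinv).resolve_left hcd

variable {𝔨 : Type*} [LieRing 𝔨] [LieAlgebra ℂ 𝔨]

/-- The span `∑_{l > 0} {X ∈ 𝔨 | [a, X] = i l X}` of the positive eigenspaces, the analogue of
`nonnegEigenSubmodule`. -/
def posEigenSubmodule (a : 𝔨) : Submodule ℂ 𝔨 :=
  ⨆ l : {x : ℝ // 0 < x},
    Module.End.eigenspace (LieAlgebra.ad ℂ 𝔨 a) (Complex.I * ((l : ℝ) : ℂ))

theorem lie_mem_posEigenSubmodule (a : 𝔨) {x y : 𝔨} (hx : x ∈ posEigenSubmodule a)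
    (hy : y ∈ posEigenSubmodule a) : ⁅x, y⁆ ∈ posEigenSubmodule a := by
  refine Submodule.iSup_induction _ (motive := fun x => ⁅x, y⁆ ∈ posEigenSubmodule a) hx
    (fun l x hx => ?_) (by simp) (fun x x' h h' => by rw [add_lie]; exact add_mem h h')
  refine Submodule.iSup_induction _ (motive := fun y => ⁅x, y⁆ ∈ posEigenSubmodule a) hy
    (fun m y hy => ?_) (by simp) (fun y y' h h' => by rw [lie_add]; exact add_mem h h')
  rw [Module.End.mem_eigenspace_iff, LieAlgebra.ad_apply] at hx hy
  refine Submodule.mem_iSup_of_mem ⟨l + m, add_pos l.2 m.2⟩ ?_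
  rw [Module.End.mem_eigenspace_iff, LieAlgebra.ad_apply, leibniz_lie, hx, hy, smul_lie,
    lie_smul, ← add_smul, Complex.ofReal_add, mul_add]

/-- The span of the positive eigenspaces as a Lie subalgebra; it is the nilradical of
`nonnegEigen a` when `a` lies in a compact real form. -/
def posEigen (a : 𝔨) : LieSubalgebra ℂ 𝔨 :=
  { posEigenSubmodule a with lie_mem' := fun hx hy => lie_mem_posEigenSubmodule a hx hy }

theorem mem_posEigen {a x : 𝔨} {μ : ℝ} (hμ : 0 < μ) (hx : ⁅a, x⁆ = (Complex.I * μ) • x) :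
    x ∈ posEigen a :=
  Submodule.mem_iSup_of_mem ⟨μ, hμ⟩ (Module.End.mem_eigenspace_iff.mpr hx)

theorem mem_nonnegEigen {a x : 𝔨} {μ : ℝ} (hμ : 0 ≤ μ) (hx : ⁅a, x⁆ = (Complex.I * μ) • x) :
    x ∈ nonnegEigen a :=
  Submodule.mem_iSup_of_mem ⟨μ, hμ⟩ (Module.End.mem_eigenspace_iff.mpr hx)

theorem lie_self_mem_posEigen {a x : 𝔨} (hx : x ∈ posEigen a) : ⁅x, a⁆ ∈ posEigen a := by
  suffices h : posEigenSubmodule a ≤ (posEigenSubmodule a).comap (LieAlgebra.ad ℂ 𝔨 a) by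
    rw [← lie_skew]
    exact neg_mem (h hx)
  refine iSup_le fun l y hy => ?_
  rw [Module.End.mem_eigenspace_iff] at hy
  rw [Submodule.mem_comap, hy]
  exact Submodule.smul_mem _ _ (mem_posEigen l.2 hy)

theorem killingForm_eq_zero_of_mem_posEigen {a x y : 𝔨} (hx : x ∈ posEigen a)
    (hy : y ∈ posEigen a) : killingForm ℂ 𝔨 x y = 0 := by
  refine Submodule.iSup_induction _ (motive := fun x => killingForm ℂ 𝔨 x y = 0) hx
    (fun l x hx => ?_) (by simp) fun x x' h h' => by
      rw [map_add, LinearMap.add_apply, h, h', add_zero]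
  refine Submodule.iSup_induction _ (motive := fun y => killingForm ℂ 𝔨 x y = 0) hy
    (fun m y hy => ?_) (map_zero _) fun y y' h h' => by rw [map_add, h, h', add_zero]
  refine killingForm_eq_zero_of_lie_eq_smul (Module.End.mem_eigenspace_iff.mp hx)
    (Module.End.mem_eigenspace_iff.mp hy) ?_
  rw [← mul_add]
  exact mul_ne_zero Complex.I_ne_zero (by exact_mod_cast (add_pos l.2 m.2).ne')

theorem isSolvable_posEigen [FiniteDimensional ℂ 𝔨] (a : 𝔨) :
    LieAlgebra.IsSolvable (posEigen a) :=
  isSolvable_of_killingForm_lie_eq_zero fun _ hx _ hy _ hz =>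
    killingForm_eq_zero_of_mem_posEigen hz ((posEigen a).lie_mem hx hy)

theorem nonnegEigenSubmodule_I_smul (a : 𝔨) :
    nonnegEigenSubmodule (Complex.I • a) =
      ⨆ l : {x : ℝ // 0 ≤ x}, Module.End.eigenspace (LieAlgebra.ad ℂ 𝔨 a) ((l : ℝ) : ℂ) := by
  refine iSup_congr fun l => ?_
  ext x
  rw [Module.End.mem_eigenspace_iff, Module.End.mem_eigenspace_iff, LieAlgebra.ad_apply,
    smul_lie, mul_smul]
  exact (smul_right_injective 𝔨 Complex.I_ne_zero).eq_iff

end PosEigen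

section CompactConj

variable {𝔨 : Type*} [LieRing 𝔨] [LieAlgebra ℂ 𝔨]

/-- `σ` is the conjugation of the complex Lie algebra `𝔨` with respect to a compact real form, and
`B` is an invariant symmetric form for which `B (σ x) y` is a Hermitian inner product. The form
agrees with the opposite of the Killing form up to the center. -/
structure IsCompactConj (σ : 𝔨 →ₗ⋆[ℂ] 𝔨) (B : LinearMap.BilinForm ℂ 𝔨) : Prop where
  conj_conj : ∀ x, σ (σ x) = x
  conj_lie : ∀ x y : 𝔨, σ ⁅x, y⁆ = ⁅σ x, σ y⁆
  form_conj : ∀ x y, B (σ x) (σ y) = starRingEnd ℂ (B x y)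
  form_symm : B.IsSymm
  form_nonneg : ∀ x, 0 ≤ (B (σ x) x).re
  form_definite : ∀ x, B (σ x) x = 0 → x = 0
  form_lie : B.lieInvariant 𝔨
  form_center : ∀ x, ∃ z ∈ LieAlgebra.center ℂ 𝔨, ∀ y, B x y = -killingForm ℂ 𝔨 x y + B z y

namespace IsCompactConj

variable {σ : 𝔨 →ₗ⋆[ℂ] 𝔨} {B : LinearMap.BilinForm ℂ 𝔨} (h : IsCompactConj σ B)
include h

/-- The Hermitian inner product `⟪x, y⟫ = B (σ x) y`. -/
@[reducible]
def core : InnerProductSpace.Core ℂ 𝔨 where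
  inner x y := B (σ x) y
  conj_inner_symm x y := by rw [← h.form_conj, h.conj_conj, h.form_symm.eq]
  re_inner_nonneg := h.form_nonneg
  add_left x y z := by rw [map_add, map_add, LinearMap.add_apply]
  smul_left x y r := by rw [map_smulₛₗ, map_smul, LinearMap.smul_apply, smul_eq_mul]
  definite := h.form_definite

theorem isCompactBracket :
    letI := h.core.toNormedAddCommGroup
    letI := InnerProductSpace.ofCore h.core.toCore
    IsCompactBracket (V := 𝔨) (LieAlgebra.ad ℂ 𝔨 : 𝔨 →ₗ[ℂ] Module.End ℂ 𝔨) σ := by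
  let _ := h.core.toNormedAddCommGroup
  let _ := InnerProductSpace.ofCore h.core.toCore
  have hinner (x y : 𝔨) : inner ℂ x y = B (σ x) y := rfl
  exact
    { skew := fun x y => (lie_skew x y).symm
      jacobi := fun x y => LinearMap.ext fun z => lie_lie x y z
      conj_conj := h.conj_conj
      conj_inner := fun x y => by rw [hinner, hinner, h.conj_conj, h.form_symm.eq]
      conj_bracket := h.conj_lie
      inner_bracket := fun x y z =>
        (congrArg (fun w => B w z) (h.conj_lie x y)).trans (h.form_lie _ _ _) }

theorem mem_posEigen_conj {a x : 𝔨} (ha : σ a = a) {μ : ℝ} (hμ : μ < 0)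
    (hx : ⁅a, x⁆ = (Complex.I * μ) • x) : σ x ∈ posEigen a := by
  refine mem_posEigen (neg_pos.mpr hμ) ?_
  rw [← congrArg (⁅·, σ x⁆) ha, ← h.conj_lie, hx, map_smulₛₗ]
  simp

variable [FiniteDimensional ℂ 𝔨]

theorem exists_eq_nonnegEigen {𝔮 : LieSubalgebra ℂ 𝔨}
    (hperp : ∀ x, (∀ y ∈ 𝔮, B y x = 0) → x ∈ 𝔮)
    (hnorm : ∀ x, (∀ y ∈ 𝔮, ⁅x, y⁆ ∈ 𝔮) → x ∈ 𝔮) :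
    ∃ a : 𝔨, σ a = a ∧ 𝔮 = nonnegEigen a ∧ ∀ u : 𝔨 ≃ₗ⁅ℂ⁆ 𝔨,
      (∀ x y, B (σ (u x)) (u y) = B (σ x) y) →
      𝔮.toSubmodule.map (u : 𝔨 →ₗ[ℂ] 𝔨) = 𝔮.toSubmodule → u a = a := by
  let _ := h.core.toNormedAddCommGroup
  let _ := InnerProductSpace.ofCore h.core.toCore
  have hbracket := h.isCompactBracket
  set ad : 𝔨 →ₗ[ℂ] Module.End ℂ 𝔨 := (LieAlgebra.ad ℂ 𝔨 : 𝔨 →ₗ[ℂ] Module.End ℂ 𝔨)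
  have hspan := hbracket.eq_iSup_eigenspace_traceVector (S := 𝔮.toSubmodule)
    (fun x => ⟨hnorm x, fun hx y hy => 𝔮.lie_mem hx hy⟩)
    (fun x hx => hperp x fun y hy => by
      rw [← h.conj_conj y]
      exact hx y hy)
  set a := traceVector ad 𝔮.toSubmodule
  refine ⟨Complex.I • a, ?_, ?_, fun u hB hu => ?_⟩
  · rw [map_smulₛₗ, hbracket.conj_traceVector, Complex.conj_I, smul_neg, neg_smul, neg_neg]
  · exact LieSubalgebra.toSubmodule_injective
      (hspan.trans (nonnegEigenSubmodule_I_smul a).symm)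
  · rw [map_smul]
    exact congrArg (Complex.I • ·)
      (map_traceVector (u.toLinearEquiv.isometryOfInner hB) (LieHom.map_lie u.toLieHom) hu)

theorem lie_eq_zero_of_killingForm_conj {x : 𝔨} (hx : killingForm ℂ 𝔨 x (σ x) = 0) (y : 𝔨) :
    ⁅x, y⁆ = 0 := by
  let _ := h.core.toNormedAddCommGroup
  let _ := InnerProductSpace.ofCore h.core.toCore
  have hadj := h.isCompactBracket.adjoint_ad x
  have htrace : LinearMap.trace ℂ 𝔨 ((LieAlgebra.ad ℂ 𝔨 x : 𝔨 →ₗ[ℂ] 𝔨) *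
      LinearMap.adjoint (LieAlgebra.ad ℂ 𝔨 x : 𝔨 →ₗ[ℂ] 𝔨)) = 0 := by
    rw [show LinearMap.adjoint (LieAlgebra.ad ℂ 𝔨 x : 𝔨 →ₗ[ℂ] 𝔨) = _ from hadj, mul_neg, map_neg,
      neg_eq_zero]
    exact hx
  exact LinearMap.congr_fun (trace_mul_adjoint_self_eq_zero_iff.mp htrace) y

theorem le_of_forall_lie_eq_smul {a : 𝔨} (ha : σ a = a) {S S' : Submodule ℂ 𝔨}
    (hS : ∀ x ∈ S, ⁅a, x⁆ ∈ S)
    (hS' : ∀ μ : ℝ, ∀ x ∈ S, ⁅a, x⁆ = (Complex.I * μ) • x → x ∈ S') : S ≤ S' := by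
  let _ := h.core.toNormedAddCommGroup
  let _ := InnerProductSpace.ofCore h.core.toCore
  have hσ : σ (-Complex.I • a) = -(-Complex.I • a) := by
    rw [map_smulₛₗ, ha]
    simp
  refine le_of_forall_eigenvector (h.isCompactBracket.isSymmetric_ad hσ) (fun x hx => ?_)
    fun μ x hx hμ => hS' μ x hx ?_
  · have hmem := S.smul_mem (-Complex.I) (hS x hx)
    rwa [← smul_lie] at hmem
  · have hμ' : ⁅-Complex.I • a, x⁆ = (μ : ℂ) • x := hμ
    rw [mul_smul, ← hμ', smul_lie, smul_smul]
    simp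

theorem mem_of_lie_mem {a : 𝔨} (ha : σ a = a) {S : Submodule ℂ 𝔨}
    (hS : ∀ x ∈ S, ⁅a, x⁆ ∈ S) (hker : ∀ x, ⁅a, x⁆ = 0 → x ∈ S) {x : 𝔨} (hx : ⁅a, x⁆ ∈ S) :
    x ∈ S := by
  suffices hle : S.comap (LieAlgebra.ad ℂ 𝔨 a) ≤ S from hle hx
  refine h.le_of_forall_lie_eq_smul ha (fun y hy => hS _ hy) fun μ y hy hμ => ?_
  rw [Submodule.mem_comap, LieAlgebra.ad_apply, hμ] at hy
  obtain rfl | hμ0 := eq_or_ne μ 0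
  · exact hker y (by rw [hμ, Complex.ofReal_zero, mul_zero, zero_smul])
  · exact (S.smul_mem_iff (mul_ne_zero Complex.I_ne_zero (by exact_mod_cast hμ0))).mp hy

theorem mem_isBorel_of_form_eq_zero {𝔟 : LieSubalgebra ℂ 𝔨} (h𝔟 : IsBorel 𝔟) {x : 𝔨}
    (hx : ∀ y ∈ 𝔟, B y x = 0) : x ∈ 𝔟 := by
  refine h𝔟.mem_of_killingForm_eq_zero fun y hy => ?_
  obtain ⟨z, hz, hform⟩ := h.form_center y
  have hz𝔟 : z ∈ 𝔟 := h𝔟.mem_of_lie_mem fun b _ => by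
    rw [(LieModule.mem_maxTrivSubmodule ℂ 𝔨 𝔨 z).mp hz b]
    exact zero_mem _
  have hxy := hform x
  rwa [hx y hy, hx z hz𝔟, add_zero, eq_comm, neg_eq_zero] at hxy

theorem exists_eq_nonnegEigen_of_isParabolic {𝔮 : LieSubalgebra ℂ 𝔨} (h𝔮 : IsParabolic 𝔮) :
    ∃ a : 𝔨, σ a = a ∧ 𝔮 = nonnegEigen a ∧ ∀ u : 𝔨 ≃ₗ⁅ℂ⁆ 𝔨,
      (∀ x y, B (σ (u x)) (u y) = B (σ x) y) →
      𝔮.toSubmodule.map (u : 𝔨 →ₗ[ℂ] 𝔨) = 𝔮.toSubmodule → u a = a := by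
  obtain ⟨𝔟, h𝔟, h𝔟𝔮⟩ := h𝔮
  obtain ⟨a, ha, h𝔟a, -⟩ := h.exists_eq_nonnegEigen (𝔮 := 𝔟)
    (fun x hx => h.mem_isBorel_of_form_eq_zero h𝔟 hx)
    fun x hx => h𝔟.mem_of_lie_mem fun y hy => by
      rw [← lie_skew]
      exact neg_mem (hx y hy)
  have hker (x : 𝔨) (hx : ⁅a, x⁆ = 0) : x ∈ 𝔟 := by
    rw [h𝔟a]
    exact mem_nonnegEigen le_rfl (by simpa using hx)
  have ha𝔮 : a ∈ 𝔮 := h𝔟𝔮 (hker a (lie_self a))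
  refine h.exists_eq_nonnegEigen
    (fun x hx => h𝔟𝔮 (h.mem_isBorel_of_form_eq_zero h𝔟 fun y hy => hx y (h𝔟𝔮 hy))) fun x hx => ?_
  refine h.mem_of_lie_mem (S := 𝔮.toSubmodule) ha (fun y hy => 𝔮.lie_mem ha𝔮 hy)
    (fun y hy => h𝔟𝔮 (hker y hy)) ?_
  rw [← lie_skew]
  exact neg_mem (hx a ha𝔮)

theorem isParabolic_nonnegEigen {a : 𝔨} (ha : σ a = a) : IsParabolic (nonnegEigen a) := by
  obtain ⟨𝔟, h𝔟, hle⟩ := exists_isBorel_ge (isSolvable_adjoin_of_mem_normalizer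
    (isSolvable_posEigen a) fun x hx => lie_self_mem_posEigen hx)
  have ha𝔟 : a ∈ 𝔟 := hle (self_mem_adjoin _)
  refine ⟨𝔟, h𝔟, h.le_of_forall_lie_eq_smul (S := 𝔟.toSubmodule)
    (S' := (nonnegEigen a).toSubmodule) ha (fun x hx => 𝔟.lie_mem ha𝔟 hx) fun μ x hx hμ => ?_⟩
  obtain hμ0 | hμ0 := le_or_gt 0 μ
  · exact mem_nonnegEigen hμ0 hμ
  have hσ𝔟 : σ x ∈ 𝔟 := hle (le_adjoin _ (h.mem_posEigen_conj ha hμ0 hμ))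
  have hc : Complex.I * (μ : ℂ) ≠ 0 := mul_ne_zero Complex.I_ne_zero (by exact_mod_cast hμ0.ne)
  have : LieAlgebra.IsSolvable 𝔟 := h𝔟.prop
  have hkilling := killingForm_lie_eq_zero_of_isSolvable ha𝔟 hx hσ𝔟
  rw [hμ, map_smul, smul_eq_zero_iff_right hc] at hkilling
  have hlie := h.lie_eq_zero_of_killingForm_conj
    ((LieModule.traceForm_comm ℂ 𝔨 𝔨 x (σ x)).trans hkilling) a
  rw [← lie_skew, neg_eq_zero, hμ, smul_eq_zero_iff_right hc] at hlie
  rw [hlie]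
  exact zero_mem _

end IsCompactConj

end CompactConj

section Complexification

theorem tensorProduct_induction₂ {R M N M' N' : Type*} [CommSemiring R] [AddCommMonoid M]
    [AddCommMonoid N] [AddCommMonoid M'] [AddCommMonoid N'] [Module R M] [Module R N] [Module R M']
    [Module R N'] {p : M ⊗[R] N → M' ⊗[R] N' → Prop}
    (tmul : ∀ a x b y, p (a ⊗ₜ x) (b ⊗ₜ y))
    (add_left : ∀ x x' y, p x y → p x' y → p (x + x') y)
    (add_right : ∀ x y y', p x y → p x y' → p x (y + y')) (x : M ⊗[R] N) (y : M' ⊗[R] N') :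
    p x y := by
  have htmul (a : M) (n : N) (y) : p (a ⊗ₜ n) y := by
    induction y with
    | zero => simpa using tmul a n 0 0
    | tmul b y => exact tmul a n b y
    | add y y' hy hy' => exact add_right _ _ _ hy hy'
  induction x with
  | zero => simpa using htmul 0 0 y
  | tmul a n => exact htmul a n y
  | add x x' hx hx' => exact add_left _ _ _ hx hx'

/-- The `A`-linear extension of an isomorphism of Lie algebras over `R`. -/
def baseChangeLieEquiv {R L L' : Type*} (A : Type*) [CommRing R] [CommRing A] [Algebra R A]
    [LieRing L] [LieAlgebra R L] [LieRing L'] [LieAlgebra R L'] (u : L ≃ₗ⁅R⁆ L') :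
    (A ⊗[R] L) ≃ₗ⁅A⁆ (A ⊗[R] L') :=
  { LinearEquiv.baseChange R A L L' u.toLinearEquiv with
    map_lie' := by
      intro x y
      change (u : L →ₗ[R] L').baseChange A ⁅x, y⁆ =
        ⁅(u : L →ₗ[R] L').baseChange A x, (u : L →ₗ[R] L').baseChange A y⁆
      induction x, y using tensorProduct_induction₂ with
      | tmul a x b y => exact congrArg ((a * b) ⊗ₜ[R] ·) (LieHom.map_lie u.toLieHom x y)
      | add_left x x' y hx hx' => simp only [add_lie, map_add, hx, hx']
      | add_right x y y' hy hy' => simp only [lie_add, map_add, hy, hy'] }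

theorem baseChangeLieEquiv_tmul {R L L' A : Type*} [CommRing R] [CommRing A] [Algebra R A]
    [LieRing L] [LieAlgebra R L] [LieRing L'] [LieAlgebra R L'] (u : L ≃ₗ⁅R⁆ L') (a : A) (x : L) :
    baseChangeLieEquiv A u (a ⊗ₜ x) = a ⊗ₜ[R] u x :=
  rfl

theorem map_nonnegEigenSubmodule {𝔨 𝔨' : Type*} [LieRing 𝔨] [LieAlgebra ℂ 𝔨] [LieRing 𝔨']
    [LieAlgebra ℂ 𝔨'] (u : 𝔨 ≃ₗ⁅ℂ⁆ 𝔨') (a : 𝔨) :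
    (nonnegEigenSubmodule a).map (u : 𝔨 →ₗ[ℂ] 𝔨') = nonnegEigenSubmodule (u a) := by
  rw [nonnegEigenSubmodule, nonnegEigenSubmodule, Submodule.map_iSup]
  refine iSup_congr fun l => ?_
  ext y
  rw [Submodule.mem_map]
  simp only [Module.End.mem_eigenspace_iff, LieAlgebra.ad_apply]
  constructor
  · rintro ⟨x, hx, rfl⟩
    exact (u.toLieHom.map_lie a x).symm.trans ((congrArg u hx).trans (map_smul u.toLieHom _ x))
  · intro hy
    refine ⟨u.symm y, u.injective ?_, u.apply_symm_apply y⟩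
    refine (u.toLieHom.map_lie a _).trans (.trans ?_ (map_smul u.toLieHom _ _).symm)
    change ⁅u a, u (u.symm y)⁆ = _ • u (u.symm y)
    rwa [u.apply_symm_apply]

variable {𝔨₀ : Type*} [LieRing 𝔨₀] [LieAlgebra ℝ 𝔨₀]

theorem map_q {u : 𝔨₀ ≃ₗ⁅ℝ⁆ 𝔨₀} {A : 𝔨₀} (hA : u A = A) :
    (q A).toSubmodule.map ((u : 𝔨₀ →ₗ[ℝ] 𝔨₀).baseChange ℂ) = (q A).toSubmodule := by
  have hmap := map_nonnegEigenSubmodule (baseChangeLieEquiv ℂ u) ((1 : ℂ) ⊗ₜ[ℝ] A)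
  rwa [baseChangeLieEquiv_tmul, hA] at hmap

@[simp]
theorem conjC_tmul (z : ℂ) (x : 𝔨₀) : conjC 𝔨₀ (z ⊗ₜ x) = starRingEnd ℂ z ⊗ₜ[ℝ] x :=
  rfl

theorem conjC_smul (c : ℂ) (x : ℂ ⊗[ℝ] 𝔨₀) :
    conjC 𝔨₀ (c • x) = starRingEnd ℂ c • conjC 𝔨₀ x := by
  induction x with
  | zero => simp
  | tmul z x => simp [TensorProduct.smul_tmul']
  | add x y hx hy => rw [smul_add, map_add, map_add, hx, hy, smul_add]

theorem conjC_conjC (x : ℂ ⊗[ℝ] 𝔨₀) : conjC 𝔨₀ (conjC 𝔨₀ x) = x := by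
  induction x with
  | zero => simp
  | tmul z x => simp
  | add x y hx hy => rw [map_add, map_add, hx, hy]

theorem conjC_lie (x y : ℂ ⊗[ℝ] 𝔨₀) : conjC 𝔨₀ ⁅x, y⁆ = ⁅conjC 𝔨₀ x, conjC 𝔨₀ y⁆ := by
  induction x, y using tensorProduct_induction₂ with
  | tmul a x b y => simp [LieAlgebra.ExtendScalars.bracket_tmul]
  | add_left x x' y hx hx' => rw [add_lie, map_add, map_add, add_lie, hx, hx']
  | add_right x y y' hy hy' =>
    rw [lie_add x, map_add, map_add, lie_add (conjC 𝔨₀ x), hy, hy']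

variable (𝔨₀) in
/-- `conjC` as a semilinear map. -/
def conjStar : (ℂ ⊗[ℝ] 𝔨₀) →ₗ⋆[ℂ] (ℂ ⊗[ℝ] 𝔨₀) :=
  { conjC 𝔨₀ with map_smul' := conjC_smul }

theorem exists_eq_re_add_im (x : ℂ ⊗[ℝ] 𝔨₀) :
    ∃ a b : 𝔨₀, x = (1 : ℂ) ⊗ₜ[ℝ] a + Complex.I • ((1 : ℂ) ⊗ₜ[ℝ] b) := by
  induction x with
  | zero => exact ⟨0, 0, by simp⟩
  | tmul z x =>
    refine ⟨z.re • x, z.im • x, ?_⟩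
    rw [TensorProduct.tmul_smul, TensorProduct.tmul_smul, TensorProduct.smul_tmul',
      TensorProduct.smul_tmul', TensorProduct.smul_tmul', ← TensorProduct.add_tmul]
    congr 1
    apply Complex.ext <;> simp
  | add x y hx hy =>
    obtain ⟨a, b, rfl⟩ := hx
    obtain ⟨c, d, rfl⟩ := hy
    refine ⟨a + c, b + d, ?_⟩
    rw [TensorProduct.tmul_add, TensorProduct.tmul_add, smul_add]
    abel

theorem exists_eq_one_tmul_of_conjC_eq {x : ℂ ⊗[ℝ] 𝔨₀} (hx : conjC 𝔨₀ x = x) :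
    ∃ a : 𝔨₀, x = (1 : ℂ) ⊗ₜ[ℝ] a := by
  obtain ⟨a, b, rfl⟩ := exists_eq_re_add_im x
  rw [map_add, conjC_smul, conjC_tmul, conjC_tmul, map_one, Complex.conj_I, add_right_inj,
    neg_smul, neg_eq_iff_add_eq_zero, ← two_smul ℂ, smul_eq_zero_iff_right two_ne_zero] at hx
  exact ⟨a, by rw [hx, add_zero]⟩

theorem one_tmul_mem_center {z : 𝔨₀} (hz : z ∈ LieAlgebra.center ℝ 𝔨₀) :
    (1 : ℂ) ⊗ₜ[ℝ] z ∈ LieAlgebra.center ℂ (ℂ ⊗[ℝ] 𝔨₀) := by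
  refine (LieModule.mem_maxTrivSubmodule _ _ _ _).mpr fun x => ?_
  induction x with
  | zero => exact zero_lie _
  | tmul c x =>
    rw [LieAlgebra.ExtendScalars.bracket_tmul, (LieModule.mem_maxTrivSubmodule _ _ _ _).mp hz x,
      TensorProduct.tmul_zero]
  | add x y hx hy => rw [add_lie, hx, hy, add_zero]

end Complexification

section CompactForm

variable {𝔨₀ : Type*} [LieRing 𝔨₀] [LieAlgebra ℝ 𝔨₀]

/-- An invariant inner product on a real Lie algebra that agrees with the opposite of the Killing
form up to the center: the compactness condition on a Lie algebra. -/
structure IsCompactForm (β : LinearMap.BilinForm ℝ 𝔨₀) : Prop where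
  symm : β.IsSymm
  posDef : β.toQuadraticMap.PosDef
  inv : β.lieInvariant 𝔨₀
  center : ∀ x, ∃ z ∈ LieAlgebra.center ℝ 𝔨₀, ∀ y, β x y = -killingForm ℝ 𝔨₀ x y + β z y

theorem baseChange_form_conjC (β : LinearMap.BilinForm ℝ 𝔨₀) (x y : ℂ ⊗[ℝ] 𝔨₀) :
    β.baseChange ℂ (conjC 𝔨₀ x) (conjC 𝔨₀ y) = starRingEnd ℂ (β.baseChange ℂ x y) := by
  induction x, y using tensorProduct_induction₂ with
  | tmul a x b y => simp
  | add_left x x' y hx hx' => simp only [map_add, LinearMap.add_apply, hx, hx']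
  | add_right x y y' hy hy' => simp only [map_add, hy, hy']

theorem baseChange_form_lieInvariant {β : LinearMap.BilinForm ℝ 𝔨₀} (h : β.lieInvariant 𝔨₀) :
    (β.baseChange ℂ).lieInvariant (ℂ ⊗[ℝ] 𝔨₀) := by
  intro x y z
  induction z with
  | zero => simp
  | add z z' hz hz' => rw [lie_add, map_add, map_add, hz, hz', neg_add]
  | tmul c z =>
    induction x, y using tensorProduct_induction₂ with
    | tmul a x b y =>
      simp [LieAlgebra.ExtendScalars.bracket_tmul, h x y z, mul_left_comm, mul_assoc]
    | add_left x x' y hx hx' =>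
      simp only [add_lie, map_add, LinearMap.add_apply, hx, hx', neg_add]
    | add_right x y y' hy hy' =>
      simp only [lie_add, map_add, LinearMap.add_apply, hy, hy', neg_add]

theorem baseChange_form_baseChangeLieEquiv {β : LinearMap.BilinForm ℝ 𝔨₀} {u : 𝔨₀ ≃ₗ⁅ℝ⁆ 𝔨₀}
    (hu : ∀ x y, β (u x) (u y) = β x y) (x y : ℂ ⊗[ℝ] 𝔨₀) :
    β.baseChange ℂ (conjC 𝔨₀ (baseChangeLieEquiv ℂ u x)) (baseChangeLieEquiv ℂ u y) =
      β.baseChange ℂ (conjC 𝔨₀ x) y := by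
  induction x, y using tensorProduct_induction₂ with
  | tmul a x b y => simp [baseChangeLieEquiv_tmul, hu]
  | add_left x x' y hx hx' => simp only [map_add, LinearMap.add_apply, hx, hx']
  | add_right x y y' hy hy' => simp only [map_add, hy, hy']

theorem baseChange_form_conjC_self {β : LinearMap.BilinForm ℝ 𝔨₀} (hβ : β.IsSymm) (a b : 𝔨₀) :
    letI x := (1 : ℂ) ⊗ₜ[ℝ] a + Complex.I • ((1 : ℂ) ⊗ₜ[ℝ] b)
    β.baseChange ℂ (conjC 𝔨₀ x) x = ((β a a + β b b : ℝ) : ℂ) := by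
  simp only [map_add, conjC_smul, conjC_tmul, map_one, Complex.conj_I, LinearMap.add_apply,
    map_smul, LinearMap.smul_apply, LinearMap.BilinForm.baseChange_tmul, hβ.eq b a, smul_eq_mul,
    neg_smul, LinearMap.neg_apply, map_neg, Complex.real_smul, mul_one, Complex.ofReal_add]
  linear_combination (-(β b b : ℂ)) * Complex.I_mul_I

namespace IsCompactForm

variable {β : LinearMap.BilinForm ℝ 𝔨₀} (h : IsCompactForm β)
include h

theorem baseChange_form_center [FiniteDimensional ℝ 𝔨₀] (x : ℂ ⊗[ℝ] 𝔨₀) :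
    ∃ z ∈ LieAlgebra.center ℂ (ℂ ⊗[ℝ] 𝔨₀), ∀ y,
      β.baseChange ℂ x y = -killingForm ℂ (ℂ ⊗[ℝ] 𝔨₀) x y + β.baseChange ℂ z y := by
  have hkilling : killingForm ℂ (ℂ ⊗[ℝ] 𝔨₀) = (killingForm ℝ 𝔨₀).baseChange ℂ :=
    LieModule.traceForm_baseChange ℝ 𝔨₀ 𝔨₀ ℂ
  obtain ⟨a, b, rfl⟩ := exists_eq_re_add_im x
  obtain ⟨z, hz, ha⟩ := h.center a
  obtain ⟨w, hw, hb⟩ := h.center b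
  refine ⟨(1 : ℂ) ⊗ₜ z + Complex.I • ((1 : ℂ) ⊗ₜ w),
    add_mem (one_tmul_mem_center hz) (Submodule.smul_mem _ _ (one_tmul_mem_center hw)), fun y => ?_⟩
  rw [hkilling]
  induction y with
  | zero => simp
  | tmul c y =>
    simp only [map_add, map_smul, LinearMap.add_apply, LinearMap.smul_apply,
      LinearMap.BilinForm.baseChange_tmul, ha y, hb y, add_smul, neg_smul, smul_add, smul_neg]
    ring
  | add y y' hy hy' =>
    rw [(β.baseChange ℂ _).map_add, ((killingForm ℝ 𝔨₀).baseChange ℂ _).map_add,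
      (β.baseChange ℂ _).map_add, hy, hy']
    ring

theorem isCompactConj [FiniteDimensional ℝ 𝔨₀] :
    IsCompactConj (conjStar 𝔨₀) (β.baseChange ℂ) where
  conj_conj := conjC_conjC
  conj_lie := conjC_lie
  form_conj := baseChange_form_conjC β
  form_symm := ⟨(LinearMap.BilinForm.IsSymm.baseChange ℂ ⟨h.symm.eq⟩).eq⟩
  form_nonneg x := by
    obtain ⟨a, b, rfl⟩ := exists_eq_re_add_im x
    exact (congrArg Complex.re (baseChange_form_conjC_self h.symm a b)).ge.trans'
      (add_nonneg (h.posDef.nonneg a) (h.posDef.nonneg b))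
  form_definite x hx := by
    obtain ⟨a, b, rfl⟩ := exists_eq_re_add_im x
    have hsum : β a a + β b b = 0 := by
      exact_mod_cast (baseChange_form_conjC_self h.symm a b).symm.trans hx
    obtain ⟨ha, hb⟩ :=
      (add_eq_zero_iff_of_nonneg (h.posDef.nonneg a) (h.posDef.nonneg b)).mp hsum
    rw [h.posDef.anisotropic a ha, h.posDef.anisotropic b hb]
    simp
  form_lie := baseChange_form_lieInvariant h.inv
  form_center := h.baseChange_form_center

theorem isParabolic_q [FiniteDimensional ℝ 𝔨₀] (A : 𝔨₀) : IsParabolic (q A) :=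
  h.isCompactConj.isParabolic_nonnegEigen (congrArg (· ⊗ₜ[ℝ] A) (map_one (starRingEnd ℂ)))

theorem exists_eq_q [FiniteDimensional ℝ 𝔨₀] {𝔮 : LieSubalgebra ℂ (ℂ ⊗[ℝ] 𝔨₀)}
    (h𝔮 : IsParabolic 𝔮) : ∃ A : 𝔨₀, 𝔮 = q A ∧ ∀ u : 𝔨₀ ≃ₗ⁅ℝ⁆ 𝔨₀,
      (∀ x y, β (u x) (u y) = β x y) →
      𝔮.toSubmodule.map ((u : 𝔨₀ →ₗ[ℝ] 𝔨₀).baseChange ℂ) = 𝔮.toSubmodule → u A = A := by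
  obtain ⟨a, ha, h𝔮a, hfix⟩ := h.isCompactConj.exists_eq_nonnegEigen_of_isParabolic h𝔮
  obtain ⟨A, rfl⟩ := exists_eq_one_tmul_of_conjC_eq ha
  refine ⟨A, h𝔮a, fun u hβ hu => ?_⟩
  have hfixA := hfix (baseChangeLieEquiv ℂ u) (baseChange_form_baseChangeLieEquiv hβ) hu
  rw [baseChangeLieEquiv_tmul, ← sub_eq_zero, ← TensorProduct.tmul_sub,
    Module.FaithfullyFlat.one_tmul_eq_zero_iff] at hfixA
  exact sub_eq_zero.mp hfixA

theorem isParabolic_and_map_eq_iff [FiniteDimensional ℝ 𝔨₀] {Φ : Set (𝔨₀ ≃ₗ⁅ℝ⁆ 𝔨₀)}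
    (hΦ : ∀ u ∈ Φ, ∀ x y, β (u x) (u y) = β x y) {𝔮 : LieSubalgebra ℂ (ℂ ⊗[ℝ] 𝔨₀)} :
    (IsParabolic 𝔮 ∧ ∀ u ∈ Φ,
      𝔮.toSubmodule.map ((u : 𝔨₀ →ₗ[ℝ] 𝔨₀).baseChange ℂ) = 𝔮.toSubmodule) ↔
      ∃ A : 𝔨₀, (∀ u ∈ Φ, u A = A) ∧ 𝔮 = q A := by
  constructor
  · rintro ⟨h𝔮, hstable⟩
    obtain ⟨A, h𝔮A, hfix⟩ := h.exists_eq_q h𝔮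
    exact ⟨A, fun u hu => hfix u (hΦ u hu) (hstable u hu), h𝔮A⟩
  · rintro ⟨A, hA, rfl⟩
    exact ⟨h.isParabolic_q A, fun u hu => map_q (hA u hu)⟩

end IsCompactForm

end CompactForm

section AdjointRepresentation

open Topology
open ContinuousLinearMap (inl inr)

theorem hasMFDerivAt_comp_of_eq {𝕜 : Type*} [NontriviallyNormedField 𝕜]
    {E F F' H H' H'' M N N' : Type*}
    [NormedAddCommGroup E] [NormedSpace 𝕜 E] [TopologicalSpace H] {I : ModelWithCorners 𝕜 E H}
    [TopologicalSpace M] [ChartedSpace H M]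
    [NormedAddCommGroup F] [NormedSpace 𝕜 F] [TopologicalSpace H'] {I' : ModelWithCorners 𝕜 F H'}
    [TopologicalSpace N] [ChartedSpace H' N]
    [NormedAddCommGroup F'] [NormedSpace 𝕜 F'] [TopologicalSpace H'']
    {I'' : ModelWithCorners 𝕜 F' H''} [TopologicalSpace N'] [ChartedSpace H'' N']
    {f : M → N} {g : N → N'} {x : M} {y : N} {f' : E →L[𝕜] F} {g' : F →L[𝕜] F'}
    (hg : HasMFDerivAt I' I'' g y g') (hf : HasMFDerivAt I I' f x f') (hy : f x = y) :
    HasMFDerivAt I I'' (g ∘ f) x (g'.comp f') := by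
  subst hy
  exact hg.comp x hf

theorem inTangentCoordinates_of_eq {E : Type*} [NormedAddCommGroup E] [NormedSpace ℝ E]
    {G : Type*} [TopologicalSpace G] [ChartedSpace E G] [IsManifold 𝓘(ℝ, E) 1 G]
    {N : Type*} {x₀ x : N} {f g : N → G} (ϕ : N → E →L[ℝ] E)
    (hf : f x = f x₀) (hg : g x = g x₀) :
    inTangentCoordinates 𝓘(ℝ, E) 𝓘(ℝ, E) f g ϕ x₀ x = ϕ x := by
  rw [inTangentCoordinates_eq _ _ _ (hf ▸ mem_chart_source E (f x))
    (hg ▸ mem_chart_source E (g x))]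
  ext v
  simp only [ContinuousLinearMap.comp_apply, hf, hg,
    (tangentBundleCore 𝓘(ℝ, E) G).coordChange_self _ _ (mem_achart_source E _)]

variable {E : Type*} [NormedAddCommGroup E] [NormedSpace ℝ E]
  {G : Type*} [TopologicalSpace G] [ChartedSpace E G] [Group G]

/-- `Ad g` as a continuous linear map of the model space `E`, which is the underlying space of the
Lie algebra of `G`. -/
def adCLM (g : G) : E →L[ℝ] E :=
  mfderiv 𝓘(ℝ, E) 𝓘(ℝ, E) (fun h : G => g * h * g⁻¹) 1

local notation "φ" => extChartAt 𝓘(ℝ, E) (1 : G)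

variable (E G) in
/-- The coordinates of the identity of `G` in the preferred chart around it. -/
def chartOne : E := φ 1

local notation "o" => chartOne E G

variable (E G) in
/-- The multiplication of `G`, read in the preferred chart around the identity. -/
def chartMul (p : E × E) : E := φ ((φ).symm p.1 * (φ).symm p.2)

local notation "μ" => chartMul E G

theorem symm_chartOne : (φ).symm o = 1 :=
  extChartAt_to_inv 1

theorem target_mem_nhds_chartOne : (φ).target ∈ 𝓝 o :=
  extChartAt_target_mem_nhds 1

theorem chartMul_chartOne_left {y : E} (hy : y ∈ (φ).target) : μ (o, y) = y := by
  rw [chartMul, symm_chartOne, one_mul, (φ).right_inv hy]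

theorem chartMul_chartOne_right {x : E} (hx : x ∈ (φ).target) : μ (x, o) = x := by
  rw [chartMul, symm_chartOne, mul_one, (φ).right_inv hx]

theorem hasFDerivAt_comp_chart_symm {F : Type*} [NormedAddCommGroup F] [NormedSpace ℝ F]
    {f : G → F} {f' : E →L[ℝ] F} (hf : HasMFDerivAt 𝓘(ℝ, E) 𝓘(ℝ, F) f 1 f') :
    HasFDerivAt (f ∘ (φ).symm) f' o := by
  have hf' : HasFDerivWithinAt (f ∘ (φ).symm) f' (Set.range 𝓘(ℝ, E)) o := hf.2
  rwa [ModelWithCorners.range_eq_univ, hasFDerivWithinAt_univ] at hf'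

theorem hasMFDerivAt_comp_chart [IsManifold 𝓘(ℝ, E) 1 G] {F : Type*} [NormedAddCommGroup F]
    [NormedSpace ℝ F] {f : E → F} {f' : E →L[ℝ] F} (hf : HasFDerivAt f f' o) :
    HasMFDerivAt 𝓘(ℝ, E) 𝓘(ℝ, F) (f ∘ φ) 1 f' := by
  have hφ : HasMFDerivAt 𝓘(ℝ, E) 𝓘(ℝ, E) φ 1 (.id ℝ E) :=
    mfderiv_extChartAt_self (I := 𝓘(ℝ, E)) (x := (1 : G)) ▸
      (mdifferentiableAt_extChartAt (mem_chart_source E (1 : G))).hasMFDerivAt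
  exact hasMFDerivAt_comp_of_eq hf.hasMFDerivAt hφ rfl

theorem hasMFDerivAt_chart_mul_left [IsManifold 𝓘(ℝ, E) 1 G] {x : E}
    (hx : DifferentiableAt ℝ μ (x, o)) :
    HasMFDerivAt 𝓘(ℝ, E) 𝓘(ℝ, E) (fun h : G => φ ((φ).symm x * h)) 1
      ((fderiv ℝ μ (x, o)).comp (inr ℝ E E)) := by
  refine (hasMFDerivAt_comp_chart (hx.hasFDerivAt.comp o
    (hasFDerivAt_prodMk_right x o))).congr_of_eventuallyEq ?_
  filter_upwards [extChartAt_source_mem_nhds (I := 𝓘(ℝ, E)) (1 : G)] with h hh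
  simp only [Function.comp_apply, chartMul, (φ).left_inv hh]

theorem hasMFDerivAt_chart_mul_right [IsManifold 𝓘(ℝ, E) 1 G] {x : E}
    (hx : DifferentiableAt ℝ μ (o, x)) :
    HasMFDerivAt 𝓘(ℝ, E) 𝓘(ℝ, E) (fun h : G => φ (h * (φ).symm x)) 1
      ((fderiv ℝ μ (o, x)).comp (inl ℝ E E)) := by
  refine (hasMFDerivAt_comp_chart (hx.hasFDerivAt.comp o
    (hasFDerivAt_prodMk_left o x))).congr_of_eventuallyEq ?_
  filter_upwards [extChartAt_source_mem_nhds (I := 𝓘(ℝ, E)) (1 : G)] with h hh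
  simp only [Function.comp_apply, chartMul, (φ).left_inv hh]

variable [LieGroup 𝓘(ℝ, E) ∞ G]

theorem hasMFDerivAt_conj (g : G) :
    HasMFDerivAt 𝓘(ℝ, E) 𝓘(ℝ, E) (fun h : G => g * h * g⁻¹) 1 (adCLM (E := E) g) :=
  (((contMDiff_const.mul contMDiff_id).mul contMDiff_const).mdifferentiableAt
    (n := ∞) (by simp)).hasMFDerivAt

theorem adCLM_one : adCLM (1 : G) = .id ℝ E := by
  refine hasMFDerivAt_unique (hasMFDerivAt_conj 1) ?_
  exact (hasMFDerivAt_id (I := 𝓘(ℝ, E)) (1 : G)).congr_of_eventuallyEq (.of_forall fun h => by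
    simp only [one_mul, inv_one, mul_one, id_eq])

theorem adCLM_mul (g h : G) : (adCLM (g * h) : E →L[ℝ] E) = (adCLM g).comp (adCLM h) := by
  refine hasMFDerivAt_unique (hasMFDerivAt_conj (g * h)) ?_
  have hcomp := hasMFDerivAt_comp_of_eq (hasMFDerivAt_conj (E := E) g) (hasMFDerivAt_conj h)
    (by rw [mul_one, mul_inv_cancel])
  exact hcomp.congr_of_eventuallyEq (.of_forall fun x => by
    simp only [Function.comp_apply, mul_assoc, mul_inv_rev])

variable (E G) in
/-- The adjoint representation of `G` on the model space. -/
def adRep : G →* (E →L[ℝ] E) where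
  toFun := adCLM
  map_one' := adCLM_one
  map_mul' := adCLM_mul

theorem fderiv_chartMul_comp_inr {x : E} (hleft : DifferentiableAt ℝ μ (x, o))
    (hright : DifferentiableAt ℝ μ (o, x)) :
    (fderiv ℝ μ (x, o)).comp (inr ℝ E E) =
      ((fderiv ℝ μ (o, x)).comp (inl ℝ E E)).comp (adCLM ((φ).symm x)) := by
  refine hasMFDerivAt_unique (hasMFDerivAt_chart_mul_left hleft) ?_
  have hcomp := hasMFDerivAt_comp_of_eq (hasMFDerivAt_chart_mul_right hright)
    (hasMFDerivAt_conj ((φ).symm x)) (by rw [mul_one, mul_inv_cancel])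
  exact hcomp.congr_of_eventuallyEq (.of_forall fun h => by
    simp only [Function.comp_apply, inv_mul_cancel_right])

theorem contMDiff_adCLM : ContMDiff 𝓘(ℝ, E) 𝓘(ℝ, E →L[ℝ] E) ∞ (adCLM (E := E) (G := G)) := by
  intro g₀
  have hconj : ContMDiff (𝓘(ℝ, E).prod 𝓘(ℝ, E)) 𝓘(ℝ, E) ∞
      (fun p : G × G => p.1 * p.2 * p.1⁻¹) :=
    (contMDiff_fst.mul contMDiff_snd).mul contMDiff_fst.inv
  refine (ContMDiffAt.mfderiv (m := ∞) (fun g h : G => g * h * g⁻¹) (fun _ => (1 : G))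
    hconj.contMDiffAt contMDiffAt_const le_rfl).congr_of_eventuallyEq
    (.of_forall fun g => ?_)
  exact (inTangentCoordinates_of_eq (f := fun _ => (1 : G)) (g := fun g : G => g * 1 * g⁻¹)
    adCLM rfl (by simp)).symm

theorem contDiffAt_chartMul : ContDiffAt ℝ ∞ μ (o, o) := by
  have hsymm : ContMDiffAt 𝓘(ℝ, E) 𝓘(ℝ, E) ∞ (φ).symm o :=
    (contMDiffOn_extChartAt_symm 1).contMDiffAt target_mem_nhds_chartOne
  have hmul := (ContMDiffAt.comp (I := 𝓘(ℝ, E × E)) (o, o) hsymm contDiffAt_fst.contMDiffAt).mul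
    (ContMDiffAt.comp (I := 𝓘(ℝ, E × E)) (o, o) hsymm contDiffAt_snd.contMDiffAt)
  refine contMDiffAt_iff_contDiffAt.mp (ContMDiffAt.comp (I' := 𝓘(ℝ, E)) (o, o) ?_ hmul)
  simp only [symm_chartOne, mul_one]
  exact contMDiffAt_extChartAt

theorem eventually_differentiableAt_chartMul :
    ∀ᶠ p in 𝓝 (o, o), DifferentiableAt ℝ μ p := by
  have hμ : ContDiffAt ℝ 1 μ (o, o) := contDiffAt_chartMul.of_le (by exact_mod_cast le_top)
  filter_upwards [hμ.eventually (by norm_num)] with p hp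
  exact hp.differentiableAt one_ne_zero

theorem differentiableAt_fderiv_chartMul : DifferentiableAt ℝ (fderiv ℝ μ) (o, o) :=
  (contDiffAt_chartMul.fderiv_right (m := 1) (WithTop.coe_le_coe.2 le_top)).differentiableAt
    one_ne_zero

theorem fderiv_chartMul_comp_inl_chartOne :
    (fderiv ℝ μ (o, o)).comp (inl ℝ E E) = .id ℝ E := by
  refine (eventually_differentiableAt_chartMul.self_of_nhds.hasFDerivAt.comp o
    (hasFDerivAt_prodMk_left (𝕜 := ℝ) o o)).unique ((hasFDerivAt_id o).congr_of_eventuallyEq ?_)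
  filter_upwards [target_mem_nhds_chartOne] with x hx using chartMul_chartOne_right hx

theorem fderiv_chartMul_comp_inr_chartOne :
    (fderiv ℝ μ (o, o)).comp (inr ℝ E E) = .id ℝ E := by
  refine (eventually_differentiableAt_chartMul.self_of_nhds.hasFDerivAt.comp o
    (hasFDerivAt_prodMk_right o o)).unique ((hasFDerivAt_id o).congr_of_eventuallyEq ?_)
  filter_upwards [target_mem_nhds_chartOne] with y hy using chartMul_chartOne_left hy

variable (E G) in
/-- The mixed second derivative at the identity of the multiplication of `G`, read in the preferred
chart: `mulHessian E G X Y` is the term of bidegree `(1, 1)` in the Taylor expansion of the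
product. -/
def mulHessian : E →L[ℝ] E →L[ℝ] E :=
  (fderiv ℝ (fderiv ℝ μ) (o, o)).bilinearComp (inl ℝ E E) (inr ℝ E E)

theorem hasFDerivAt_fderiv_chartMul_inr (Y : E) :
    HasFDerivAt (fun x => fderiv ℝ μ (x, o) (0, Y)) ((mulHessian E G).flip Y) o := by
  have hD := HasFDerivAt.comp (f := fun e : E => (e, o)) o
    (differentiableAt_fderiv_chartMul (G := G)).hasFDerivAt
    (hasFDerivAt_prodMk_left (𝕜 := ℝ) o o)
  refine (hD.clm_apply (hasFDerivAt_const ((0, Y) : E × E) o)).congr_fderiv ?_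
  ext X
  simp [mulHessian]

theorem hasFDerivAt_fderiv_chartMul_inl {a : E → E} {a' : E →L[ℝ] E} (ha : HasFDerivAt a a' o) :
    HasFDerivAt (fun x => fderiv ℝ μ (o, x) (a x, 0)) (mulHessian E G (a o) + a') o := by
  have hD := HasFDerivAt.comp (f := fun e : E => (o, e)) o
    (differentiableAt_fderiv_chartMul (G := G)).hasFDerivAt
    (hasFDerivAt_prodMk_right (𝕜 := ℝ) o o)
  have hsymm : IsSymmSndFDerivAt ℝ μ (o, o) := contDiffAt_chartMul.isSymmSndFDerivAt
    (by rw [minSmoothness_of_isRCLikeNormedField]; exact WithTop.coe_le_coe.2 le_top)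
  refine (hD.clm_apply ((inl ℝ E E).hasFDerivAt.comp o ha)).congr_fderiv ?_
  ext X
  have hid : fderiv ℝ μ (o, o) (a' X, 0) = a' X :=
    DFunLike.congr_fun (fderiv_chartMul_comp_inl_chartOne (G := G)) (a' X)
  simp [mulHessian, hsymm (0, X) (a o, 0), hid, add_comm]

theorem eventually_differentiableAt_chartMul_left : ∀ᶠ x in 𝓝 o, DifferentiableAt ℝ μ (x, o) :=
  (Continuous.prodMk_left o).continuousAt.eventually eventually_differentiableAt_chartMul

theorem eventually_differentiableAt_chartMul_right : ∀ᶠ x in 𝓝 o, DifferentiableAt ℝ μ (o, x) :=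
  (Continuous.prodMk_right o).continuousAt.eventually eventually_differentiableAt_chartMul

variable (G) in
/-- The left-invariant vector field on `G` with value `Y` at the identity, read in the preferred
chart around the identity. -/
def chartField (Y : E) (x : E) : E :=
  VectorField.mpullbackWithin 𝓘(ℝ, E) 𝓘(ℝ, E) (φ).symm
    (mulInvariantVectorField (I := 𝓘(ℝ, E)) (G := G) Y) (Set.range 𝓘(ℝ, E)) x

theorem chartField_eq (Y : E) {x : E} (hx : x ∈ (φ).target) (hμ : DifferentiableAt ℝ μ (x, o)) :
    chartField G Y x = fderiv ℝ μ (x, o) (0, Y) := by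
  have hinv : (mfderivWithin 𝓘(ℝ, E) 𝓘(ℝ, E) (φ).symm (Set.range 𝓘(ℝ, E)) x).inverse =
      mfderiv 𝓘(ℝ, E) 𝓘(ℝ, E) φ ((φ).symm x) :=
    ContinuousLinearMap.inverse_eq (mfderivWithin_extChartAt_symm_comp_mfderiv_extChartAt hx)
      (mfderiv_extChartAt_comp_mfderivWithin_extChartAt_symm hx)
  have hsource : (φ).symm x ∈ (chartAt E (1 : G)).source :=
    extChartAt_source 𝓘(ℝ, E) (1 : G) ▸ (φ).map_target hx
  have hmul : MDifferentiableAt 𝓘(ℝ, E) 𝓘(ℝ, E) (fun h : G => (φ).symm x * h) 1 :=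
    (contMDiff_mul_left (I := 𝓘(ℝ, E)) (n := ∞)).mdifferentiableAt (by simp)
  have hunique := hasMFDerivAt_unique (hasMFDerivAt_chart_mul_left hμ)
    (hasMFDerivAt_comp_of_eq (mdifferentiableAt_extChartAt hsource).hasMFDerivAt
      hmul.hasMFDerivAt (mul_one _))
  exact (DFunLike.congr_fun (F := E →L[ℝ] E) hinv _).trans (DFunLike.congr_fun hunique Y).symm

theorem chartField_chartOne (Y : E) : chartField G Y o = Y :=
  (chartField_eq Y (mem_of_mem_nhds target_mem_nhds_chartOne)
    eventually_differentiableAt_chartMul.self_of_nhds).trans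
    (DFunLike.congr_fun fderiv_chartMul_comp_inr_chartOne Y)

theorem fderiv_chartField (Y : E) :
    fderiv ℝ (chartField G Y) o = (mulHessian E G).flip Y := by
  refine ((hasFDerivAt_fderiv_chartMul_inr Y).congr_of_eventuallyEq ?_).fderiv
  filter_upwards [target_mem_nhds_chartOne, eventually_differentiableAt_chartMul_left] with x hx hμ
    using chartField_eq Y hx hμ

theorem lie_eq_lieBracket_chartField (X Y : GroupLieAlgebra 𝓘(ℝ, E) G) :
    ⁅X, Y⁆ = VectorField.lieBracket ℝ (chartField (E := E) G X) (chartField G Y) o := by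
  have huniv : (φ).symm ⁻¹' Set.univ ∩ Set.range 𝓘(ℝ, E) = Set.univ := by simp
  have hlie : ∀ T : E →L[ℝ] E, mfderiv 𝓘(ℝ, E) 𝓘(ℝ, E) φ 1 = T →
      ⁅X, Y⁆ = T.inverse (VectorField.lieBracketWithin ℝ (chartField G X) (chartField G Y)
        ((φ).symm ⁻¹' Set.univ ∩ Set.range 𝓘(ℝ, E)) o) := by
    rintro _ rfl
    rfl
  rw [hlie _ mfderiv_extChartAt_self, huniv, VectorField.lieBracketWithin_univ]
  exact DFunLike.congr_fun (F := E →L[ℝ] E) ContinuousLinearMap.inverse_id _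

theorem lieBracket_chartField (X Y : E) :
    VectorField.lieBracket ℝ (chartField G X) (chartField G Y) o =
      mulHessian E G X Y - mulHessian E G Y X := by
  simp only [VectorField.lieBracket, fderiv_chartField, chartField_chartOne,
    ContinuousLinearMap.flip_apply]

theorem lie_eq_mulHessian_sub (X Y : GroupLieAlgebra 𝓘(ℝ, E) G) :
    ⁅X, Y⁆ = mulHessian E G X Y - mulHessian E G Y X :=
  (lie_eq_lieBracket_chartField X Y).trans (lieBracket_chartField (E := E) X Y)

/- The identity `g h = (g h g⁻¹) g`, differentiated in `h` at the identity and then in `g`,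
expresses the differential of the adjoint representation through the Hessian of the product. -/
theorem hasMFDerivAt_adCLM_apply (Y : E) :
    HasMFDerivAt 𝓘(ℝ, E) 𝓘(ℝ, E) (fun g : G => adCLM g Y) 1
      ((mulHessian E G).flip Y - mulHessian E G Y) := by
  have hdiff : MDifferentiableAt 𝓘(ℝ, E) 𝓘(ℝ, E) (fun g : G => adCLM g Y) 1 :=
    ((ContinuousLinearMap.apply ℝ E Y).contMDiff.comp contMDiff_adCLM).mdifferentiableAt
      (n := ∞) (by simp)
  obtain ⟨a', ha'⟩ : ∃ a' : E →L[ℝ] E,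
      HasMFDerivAt 𝓘(ℝ, E) 𝓘(ℝ, E) (fun g : G => adCLM g Y) 1 a' := ⟨_, hdiff.hasMFDerivAt⟩
  have hright := hasFDerivAt_fderiv_chartMul_inl (hasFDerivAt_comp_chart_symm ha')
  have hleft : HasFDerivAt (fun x => fderiv ℝ μ (x, o) (0, Y)) _ o :=
    hright.congr_of_eventuallyEq <| by
      filter_upwards [eventually_differentiableAt_chartMul_left,
        eventually_differentiableAt_chartMul_right] with x hx hx'
      exact DFunLike.congr_fun (fderiv_chartMul_comp_inr hx hx') Y
  have h := (hasFDerivAt_fderiv_chartMul_inr Y).unique hleft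
  rw [Function.comp_apply, symm_chartOne, adCLM_one, ContinuousLinearMap.id_apply] at h
  rwa [h, add_sub_cancel_left]

theorem Ad_lie (g : G) (X Y : GroupLieAlgebra 𝓘(ℝ, E) G) : Ad g ⁅X, Y⁆ = ⁅Ad g X, Ad g Y⁆ := by
  have hleft := hasMFDerivAt_comp_of_eq (adCLM (E := E) g).hasMFDerivAt
    (hasMFDerivAt_adCLM_apply (E := E) (G := G) Y) rfl
  have hright := hasMFDerivAt_comp_of_eq
    (hasMFDerivAt_adCLM_apply (E := E) (G := G) (adCLM (E := E) g Y))
    (hasMFDerivAt_conj g) (by rw [mul_one, mul_inv_cancel])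
  have hderiv := hasMFDerivAt_unique hleft (hright.congr_of_eventuallyEq (.of_forall fun k => ?_))
  · rw [lie_eq_mulHessian_sub, lie_eq_mulHessian_sub]
    exact congrArg (fun T : E →L[ℝ] E => T X) hderiv
  · change (adCLM (E := E) g).comp (adCLM k) Y =
      (adCLM (E := E) (g * k * g⁻¹)).comp (adCLM g) Y
    rw [← adCLM_mul, ← adCLM_mul, inv_mul_cancel_right]

theorem lieInvariant_of_Ad_invariant [FiniteDimensional ℝ E]
    {β : LinearMap.BilinForm ℝ (GroupLieAlgebra 𝓘(ℝ, E) G)}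
    (hβ : ∀ (g : G) X Y, β (Ad g X) (Ad g Y) = β X Y) :
    β.lieInvariant (GroupLieAlgebra 𝓘(ℝ, E) G) := by
  intro X Y Z
  let B : E →L[ℝ] E →L[ℝ] ℝ := LinearMap.toContinuousBilinearMap (E := E) (F := E) β
  have hY := hasFDerivAt_comp_chart_symm (hasMFDerivAt_adCLM_apply (E := E) (G := G) Y)
  have hZ := hasFDerivAt_comp_chart_symm (hasMFDerivAt_adCLM_apply (E := E) (G := G) Z)
  have hconst : HasFDerivAt
      (fun x => B (adCLM (E := E) ((φ).symm x) Y) (adCLM (E := E) ((φ).symm x) Z)) 0 o :=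
    HasFDerivAt.congr_of_eventuallyEq (hasFDerivAt_const (𝕜 := ℝ) (β Y Z : ℝ) o)
      (.of_forall fun x => hβ _ Y Z)
  have hsum := congrArg (fun T : E →L[ℝ] ℝ => T X)
    ((B.hasFDerivAt_of_bilinear (G' := E) hY hZ).unique hconst)
  simp only [Function.comp_apply, symm_chartOne, adCLM_one] at hsum
  rw [lie_eq_mulHessian_sub, lie_eq_mulHessian_sub]
  exact eq_neg_of_add_eq_zero_right hsum

/-- `Ad g` as an automorphism of the Lie algebra of `G`. -/
def AdEquiv [CompleteSpace E] (g : G) :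
    GroupLieAlgebra 𝓘(ℝ, E) G ≃ₗ⁅ℝ⁆ GroupLieAlgebra 𝓘(ℝ, E) G :=
  { Ad g with
    map_lie' := Ad_lie g _ _
    invFun := Ad g⁻¹
    left_inv := fun X => by
      have h := adCLM_mul (E := E) g⁻¹ g
      rw [inv_mul_cancel, adCLM_one] at h
      exact (DFunLike.congr_fun (F := E →L[ℝ] E) h X).symm
    right_inv := fun X => by
      have h := adCLM_mul (E := E) g g⁻¹
      rw [mul_inv_cancel, adCLM_one] at h
      exact (DFunLike.congr_fun (F := E →L[ℝ] E) h X).symm }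

end AdjointRepresentation

section SkewTrace

variable {V : Type*} [AddCommGroup V] [Module ℝ V] [FiniteDimensional ℝ V]
  {β : LinearMap.BilinForm ℝ V}

theorem exists_basis_trace_comp_self_eq_neg_sum (hsymm : β.IsSymm)
    (hpos : β.toQuadraticMap.PosDef) :
    ∃ (n : ℕ) (b : Module.Basis (Fin n) ℝ V), ∀ T : Module.End ℝ V, β.IsSkewAdjoint T →
      LinearMap.trace ℝ V (T ∘ₗ T) = -∑ i, β (T (b i)) (T (b i)) := by
  let core : InnerProductSpace.Core ℝ V :=
    { inner := fun x y => β x y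
      conj_inner_symm := fun x y => hsymm.eq y x
      re_inner_nonneg := hpos.nonneg
      add_left := fun x y z => by simp
      smul_left := fun x y r => by simp
      definite := hpos.anisotropic }
  let _ : NormedAddCommGroup V := core.toNormedAddCommGroup
  let _ : InnerProductSpace ℝ V := InnerProductSpace.ofCore core.toCore
  refine ⟨_, (stdOrthonormalBasis ℝ V).toBasis, fun T hT => ?_⟩
  rw [LinearMap.trace_eq_sum_inner _ (stdOrthonormalBasis ℝ V), ← Finset.sum_neg_distrib]
  refine Finset.sum_congr rfl fun i _ => ?_
  rw [OrthonormalBasis.coe_toBasis, hT, Pi.neg_apply, map_neg, neg_neg]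
  rfl

theorem trace_comp_self_nonpos (hsymm : β.IsSymm) (hpos : β.toQuadraticMap.PosDef)
    {T : Module.End ℝ V} (hT : β.IsSkewAdjoint T) : LinearMap.trace ℝ V (T ∘ₗ T) ≤ 0 := by
  obtain ⟨n, b, hb⟩ := exists_basis_trace_comp_self_eq_neg_sum hsymm hpos
  rw [hb T hT, neg_nonpos]
  exact Finset.sum_nonneg fun i _ => hpos.nonneg _

theorem eq_zero_of_trace_comp_self_eq_zero (hsymm : β.IsSymm) (hpos : β.toQuadraticMap.PosDef)
    {T : Module.End ℝ V} (hT : β.IsSkewAdjoint T) (h : LinearMap.trace ℝ V (T ∘ₗ T) = 0) :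
    T = 0 := by
  obtain ⟨n, b, hb⟩ := exists_basis_trace_comp_self_eq_neg_sum hsymm hpos
  rw [hb T hT, neg_eq_zero] at h
  have hTb := (Finset.sum_eq_zero_iff_of_nonneg fun i _ => hpos.nonneg (T (b i))).mp h
  exact b.ext fun i => hpos.anisotropic _ (hTb i (Finset.mem_univ i))

theorem isCompl_orthogonal_of_posDef (hsymm : β.IsSymm) (hpos : β.toQuadraticMap.PosDef)
    (W : Submodule ℝ V) : IsCompl W (β.orthogonal W) :=
  (LinearMap.BilinForm.isCompl_orthogonal_iff_disjoint hsymm.isRefl).mpr <|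
    Submodule.disjoint_def.mpr fun x hx hx' => hpos.anisotropic x (hx' x hx)

end SkewTrace

section AdaptedForm

open LieAlgebra (center)

variable {𝔨₀ : Type*} [LieRing 𝔨₀] [LieAlgebra ℝ 𝔨₀]

theorem lieEquiv_mem_center (u : 𝔨₀ ≃ₗ⁅ℝ⁆ 𝔨₀) {z : 𝔨₀} (hz : z ∈ center ℝ 𝔨₀) :
    u z ∈ center ℝ 𝔨₀ := by
  refine (LieModule.mem_maxTrivSubmodule _ _ _ _).mpr fun x => ?_
  have hxz : ⁅u.symm x, z⁆ = 0 := (LieModule.mem_maxTrivSubmodule _ _ _ _).mp hz _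
  calc ⁅x, u z⁆ = u ⁅u.symm x, z⁆ := by rw [LieEquiv.map_lie, u.apply_symm_apply]
    _ = 0 := by rw [hxz, map_zero]

theorem killingForm_eq_zero_of_mem_center {z : 𝔨₀} (hz : z ∈ center ℝ 𝔨₀) :
    killingForm ℝ 𝔨₀ z = 0 := by
  have had : LieAlgebra.ad ℝ 𝔨₀ z = 0 := by
    rwa [← LieAlgebra.self_module_ker_eq_center] at hz
  ext x
  rw [killingForm_apply_apply, had, LinearMap.zero_comp, map_zero, LinearMap.zero_apply]

variable {β : LinearMap.BilinForm ℝ 𝔨₀} (hsymm : β.IsSymm) (hpos : β.toQuadraticMap.PosDef)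

theorem isSkewAdjoint_ad (hinv : β.lieInvariant 𝔨₀) (x : 𝔨₀) :
    β.IsSkewAdjoint (LieAlgebra.ad ℝ 𝔨₀ x) := fun y z => by
  rw [LieAlgebra.ad_apply, hinv, Pi.neg_apply, LieAlgebra.ad_apply, map_neg]

theorem lie_mem_orthogonal_center (hinv : β.lieInvariant 𝔨₀) (x y : 𝔨₀) :
    ⁅x, y⁆ ∈ β.orthogonal (center ℝ 𝔨₀).toSubmodule := fun z hz => by
  have hxz : ⁅x, z⁆ = 0 := (LieModule.mem_maxTrivSubmodule _ _ _ _).mp hz x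
  have h := hinv x z y
  rwa [hxz, map_zero, LinearMap.zero_apply, zero_eq_neg] at h

variable [FiniteDimensional ℝ 𝔨₀]

include hsymm hpos in
theorem killingForm_self_nonpos (hinv : β.lieInvariant 𝔨₀) (x : 𝔨₀) :
    killingForm ℝ 𝔨₀ x x ≤ 0 :=
  trace_comp_self_nonpos hsymm hpos (isSkewAdjoint_ad hinv x)

include hsymm hpos in
theorem mem_center_of_killingForm_self_eq_zero (hinv : β.lieInvariant 𝔨₀) {x : 𝔨₀}
    (hx : killingForm ℝ 𝔨₀ x x = 0) : x ∈ center ℝ 𝔨₀ := by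
  rw [← LieAlgebra.self_module_ker_eq_center]
  exact eq_zero_of_trace_comp_self_eq_zero hsymm hpos (isSkewAdjoint_ad hinv x) hx

/-- The projection to the center of `𝔨₀`, orthogonal for an inner product `β`. -/
def centerProj : Module.End ℝ 𝔨₀ :=
  (center ℝ 𝔨₀).toSubmodule.projection _ (isCompl_orthogonal_of_posDef hsymm hpos _)

theorem centerProj_mem (x : 𝔨₀) : centerProj hsymm hpos x ∈ center ℝ 𝔨₀ :=
  Submodule.projection_apply_mem (isCompl_orthogonal_of_posDef hsymm hpos _) x

theorem centerProj_of_mem {z : 𝔨₀} (hz : z ∈ center ℝ 𝔨₀) : centerProj hsymm hpos z = z :=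
  Submodule.projection_apply_of_mem_left (isCompl_orthogonal_of_posDef hsymm hpos _) hz

theorem centerProj_eq_zero_iff {x : 𝔨₀} :
    centerProj hsymm hpos x = 0 ↔ x ∈ β.orthogonal (center ℝ 𝔨₀).toSubmodule :=
  Submodule.projection_apply_eq_zero_iff (isCompl_orthogonal_of_posDef hsymm hpos _)

theorem centerProj_lieEquiv {u : 𝔨₀ ≃ₗ⁅ℝ⁆ 𝔨₀} (hu : ∀ x y, β (u x) (u y) = β x y) (x : 𝔨₀) :
    centerProj hsymm hpos (u x) = u (centerProj hsymm hpos x) := by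
  have horth : u x - u (centerProj hsymm hpos x) ∈
      β.orthogonal (center ℝ 𝔨₀).toSubmodule := fun z hz => by
    rw [← u.apply_symm_apply z, ← map_sub]
    exact (hu _ _).trans (Submodule.sub_projection_mem
      (isCompl_orthogonal_of_posDef hsymm hpos _) x _ (lieEquiv_mem_center u.symm hz))
  rw [← centerProj_eq_zero_iff hsymm hpos, map_sub, sub_eq_zero] at horth
  rw [horth, centerProj_of_mem hsymm hpos (lieEquiv_mem_center u (centerProj_mem hsymm hpos x))]

/-- The inner product obtained from an invariant inner product `β` by replacing it with the
opposite of the Killing form on the orthogonal complement of the center. -/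
def adaptedForm : LinearMap.BilinForm ℝ 𝔨₀ :=
  -killingForm ℝ 𝔨₀ + β.compl₁₂ (centerProj hsymm hpos) (centerProj hsymm hpos)

theorem adaptedForm_apply (x y : 𝔨₀) : adaptedForm hsymm hpos x y =
    -killingForm ℝ 𝔨₀ x y + β (centerProj hsymm hpos x) (centerProj hsymm hpos y) :=
  rfl

theorem adaptedForm_lieEquiv {u : 𝔨₀ ≃ₗ⁅ℝ⁆ 𝔨₀} (hu : ∀ x y, β (u x) (u y) = β x y) (x y : 𝔨₀) :
    adaptedForm hsymm hpos (u x) (u y) = adaptedForm hsymm hpos x y := by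
  rw [adaptedForm_apply, adaptedForm_apply, centerProj_lieEquiv hsymm hpos hu,
    centerProj_lieEquiv hsymm hpos hu, hu, LieAlgebra.killingForm_of_equiv_apply]

theorem posDef_adaptedForm (hinv : β.lieInvariant 𝔨₀) :
    (adaptedForm hsymm hpos).toQuadraticMap.PosDef := by
  intro x hx
  rw [LinearMap.BilinMap.toQuadraticMap_apply, adaptedForm_apply]
  have hβ : 0 ≤ β (centerProj hsymm hpos x) (centerProj hsymm hpos x) := hpos.nonneg _
  obtain hlt | heq := (killingForm_self_nonpos hsymm hpos hinv x).lt_or_eq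
  · linarith
  · rw [heq, neg_zero, zero_add,
      centerProj_of_mem hsymm hpos (mem_center_of_killingForm_self_eq_zero hsymm hpos hinv heq)]
    exact hpos x hx

theorem isCompactForm_adaptedForm (hinv : β.lieInvariant 𝔨₀) :
    IsCompactForm (adaptedForm hsymm hpos) where
  symm := ⟨fun x y => by
    simp only [adaptedForm_apply, hsymm.eq (centerProj hsymm hpos x),
      LieModule.traceForm_comm ℝ 𝔨₀ 𝔨₀ x]⟩
  posDef := posDef_adaptedForm hsymm hpos hinv
  inv x y z := by
    have hlie : ∀ y, centerProj hsymm hpos ⁅x, y⁆ = 0 := fun y =>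
      (centerProj_eq_zero_iff hsymm hpos).mpr (lie_mem_orthogonal_center hinv x y)
    rw [adaptedForm_apply, adaptedForm_apply, hlie, hlie,
      LieModule.traceForm_lieInvariant ℝ 𝔨₀ 𝔨₀ x y z, map_zero, map_zero, LinearMap.zero_apply,
      add_zero, add_zero]
  center x := ⟨centerProj hsymm hpos x, centerProj_mem hsymm hpos x, fun y => by
    rw [adaptedForm_apply, adaptedForm_apply,
      killingForm_eq_zero_of_mem_center (centerProj_mem hsymm hpos x), LinearMap.zero_apply,
      neg_zero, zero_add, centerProj_of_mem hsymm hpos (centerProj_mem hsymm hpos x)]⟩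

end AdaptedForm

section Averaging

open MeasureTheory

variable {E : Type*} [NormedAddCommGroup E] [NormedSpace ℝ E]

section Haar

variable {G : Type*} [TopologicalSpace G] [CompactSpace G] [Group G] [IsTopologicalGroup G]
  [MeasurableSpace G] [BorelSpace G] {ρ : G →* (E →L[ℝ] E)}

theorem integrable_bilin_orbit (hρ : Continuous ρ) (B : E →L[ℝ] E →L[ℝ] ℝ) (X Y : E) :
    Integrable (fun g => B (ρ g⁻¹ X) (ρ g⁻¹ Y)) (Measure.haar : Measure G) := by
  have hρinv : Continuous fun g => ρ g⁻¹ := hρ.comp continuous_inv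
  have hcont : Continuous fun g => B (ρ g⁻¹ X) (ρ g⁻¹ Y) :=
    (B.continuous.comp (hρinv.clm_apply continuous_const)).clm_apply
      (hρinv.clm_apply continuous_const)
  exact hcont.integrable_of_hasCompactSupport (HasCompactSupport.of_compactSpace _)

/-- The average over a compact group of the translates of a bilinear form `B` under a continuous
representation `ρ`. -/
def haarAverage (hρ : Continuous ρ) (B : E →L[ℝ] E →L[ℝ] ℝ) : LinearMap.BilinForm ℝ E :=
  LinearMap.mk₂ ℝ (fun X Y => ∫ g, B (ρ g⁻¹ X) (ρ g⁻¹ Y) ∂Measure.haar)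
    (fun X X' Y => by
      simp only [map_add, add_apply]
      exact integral_add (integrable_bilin_orbit hρ B X Y) (integrable_bilin_orbit hρ B X' Y))
    (fun c X Y => by
      simp only [map_smul, smul_apply]
      exact integral_smul c _)
    (fun X Y Y' => by
      simp only [map_add]
      exact integral_add (integrable_bilin_orbit hρ B X Y) (integrable_bilin_orbit hρ B X Y'))
    (fun c X Y => by
      simp only [map_smul]
      exact integral_smul c _)

theorem haarAverage_apply (hρ : Continuous ρ) (B : E →L[ℝ] E →L[ℝ] ℝ) (X Y : E) :
    haarAverage hρ B X Y = ∫ g, B (ρ g⁻¹ X) (ρ g⁻¹ Y) ∂Measure.haar :=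
  rfl

theorem haarAverage_map (hρ : Continuous ρ) (B : E →L[ℝ] E →L[ℝ] ℝ) (h : G) (X Y : E) :
    haarAverage hρ B (ρ h X) (ρ h Y) = haarAverage hρ B X Y := by
  rw [haarAverage_apply, haarAverage_apply,
    ← integral_mul_left_eq_self (fun g => B (ρ g⁻¹ X) (ρ g⁻¹ Y)) h⁻¹]
  simp only [mul_inv_rev, inv_inv, map_mul, mul_apply_eq_comp]

variable {B : E →L[ℝ] E →L[ℝ] ℝ}

theorem isSymm_haarAverage (hρ : Continuous ρ) (hB : B.toBilinForm.IsSymm) :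
    (haarAverage hρ B).IsSymm :=
  ⟨fun X Y => integral_congr_ae (.of_forall fun g => hB.eq (ρ g⁻¹ X) (ρ g⁻¹ Y))⟩

theorem posDef_haarAverage (hρ : Continuous ρ) (hB : B.toBilinForm.toQuadraticMap.PosDef) :
    (haarAverage hρ B).toQuadraticMap.PosDef := by
  intro X hX
  have hρinv : Continuous fun g => ρ g⁻¹ := hρ.comp continuous_inv
  have hcont : Continuous fun g => B (ρ g⁻¹ X) (ρ g⁻¹ X) :=
    (B.continuous.comp (hρinv.clm_apply continuous_const)).clm_apply
      (hρinv.clm_apply continuous_const)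
  refine hcont.integral_pos_of_hasCompactSupport_nonneg_nonzero (x := 1)
    (HasCompactSupport.of_compactSpace _) (fun g => hB.nonneg (ρ g⁻¹ X)) ?_
  rw [inv_one, map_one]
  exact (hB X hX).ne'

end Haar

variable [FiniteDimensional ℝ E]

variable (E) in
theorem exists_isSymm_posDef :
    ∃ B : E →L[ℝ] E →L[ℝ] ℝ, B.toBilinForm.IsSymm ∧ B.toBilinForm.toQuadraticMap.PosDef := by
  let e : E →L[ℝ] EuclideanSpace ℝ (Fin (Module.finrank ℝ E)) := (toEuclidean : E ≃L[ℝ] _)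
  refine ⟨(innerSL ℝ).bilinearComp e e, ⟨fun X Y => real_inner_comm (e Y) (e X)⟩, fun X hX => ?_⟩
  exact real_inner_self_pos.mpr (toEuclidean.map_ne_zero_iff.mpr hX)

theorem exists_invariant_isSymm_posDef {G : Type*} [TopologicalSpace G] [CompactSpace G] [Group G]
    [IsTopologicalGroup G] {ρ : G →* (E →L[ℝ] E)} (hρ : Continuous ρ) :
    ∃ β : LinearMap.BilinForm ℝ E, β.IsSymm ∧ β.toQuadraticMap.PosDef ∧
      ∀ g X Y, β (ρ g X) (ρ g Y) = β X Y := by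
  borelize G
  obtain ⟨B, hsymm, hpos⟩ := exists_isSymm_posDef E
  exact ⟨haarAverage hρ B, isSymm_haarAverage hρ hsymm, posDef_haarAverage hρ hpos,
    haarAverage_map hρ B⟩

end Averaging

section CompactGroup

variable {E : Type*} [NormedAddCommGroup E] [NormedSpace ℝ E] [FiniteDimensional ℝ E]
  [CompleteSpace E] {G : Type*} [TopologicalSpace G] [CompactSpace G] [ChartedSpace E G] [Group G]
  [LieGroup 𝓘(ℝ, E) ∞ G]

variable (E G) in
theorem exists_isCompactForm_groupLieAlgebra :
    ∃ β : LinearMap.BilinForm ℝ (GroupLieAlgebra 𝓘(ℝ, E) G), IsCompactForm β ∧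
      ∀ (g : G) X Y, β (AdEquiv g X) (AdEquiv g Y) = β X Y := by
  have : FiniteDimensional ℝ (GroupLieAlgebra 𝓘(ℝ, E) G) := ‹FiniteDimensional ℝ E›
  have : IsTopologicalGroup G := topologicalGroup_of_lieGroup 𝓘(ℝ, E) ∞
  obtain ⟨β, hsymm, hpos, hβ⟩ : ∃ β : LinearMap.BilinForm ℝ (GroupLieAlgebra 𝓘(ℝ, E) G),
      β.IsSymm ∧ β.toQuadraticMap.PosDef ∧ ∀ (g : G) X Y, β (Ad g X) (Ad g Y) = β X Y :=
    exists_invariant_isSymm_posDef (ρ := adRep E G) contMDiff_adCLM.continuous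
  exact ⟨adaptedForm hsymm hpos, isCompactForm_adaptedForm hsymm hpos
    (lieInvariant_of_Ad_invariant hβ), fun g => adaptedForm_lieEquiv hsymm hpos (hβ g)⟩

theorem isParabolic_and_AdStable_iff {M₀ : Subgroup G}
    {𝔮 : LieSubalgebra ℂ (ℂ ⊗[ℝ] GroupLieAlgebra 𝓘(ℝ, E) G)} :
    (IsParabolic 𝔮 ∧ ∀ g ∈ M₀, AdStable g 𝔮) ↔ ∃ A ∈ adFixed M₀, 𝔮 = q A := by
  have : FiniteDimensional ℝ (GroupLieAlgebra 𝓘(ℝ, E) G) := ‹FiniteDimensional ℝ E›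
  obtain ⟨β, hβ, hinv⟩ := exists_isCompactForm_groupLieAlgebra E G
  simpa only [Set.forall_mem_image, SetLike.mem_coe] using!
    hβ.isParabolic_and_map_eq_iff (Φ := AdEquiv '' (M₀ : Set G)) (𝔮 := 𝔮)
      (Set.forall_mem_image.mpr fun g _ => hinv g)

end CompactGroup

end CRLie

end

theorem mainTheorem11_general {E : Type*} [NormedAddCommGroup E] [NormedSpace ℝ E]
    [FiniteDimensional ℝ E] [CompleteSpace E] {K₀ : Type*} [TopologicalSpace K₀] [CompactSpace K₀]
    [Group K₀] [ChartedSpace E K₀] [LieGroup 𝓘(ℝ, E) ∞ K₀] (M₀ : Subgroup K₀)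
    (𝔳 : LieSubalgebra ℂ (ℂ ⊗[ℝ] GroupLieAlgebra 𝓘(ℝ, E) K₀)) :
    CRLie.ParAdm 𝔳 M₀ =
      {𝔮 | ∃ A ∈ CRLie.adFixed M₀, 𝔳 ≤ CRLie.q A ∧
        CRLie.nilr 𝔳 ∩ CRLie.leviPart (CRLie.q A) = {0} ∧ 𝔮 = CRLie.q A} ∧
    {𝔮 : LieSubalgebra ℂ (ℂ ⊗[ℝ] GroupLieAlgebra 𝓘(ℝ, E) K₀) |
        CRLie.IsParabolic 𝔮 ∧ 𝔳 ≤ 𝔮 ∧ ∀ g ∈ M₀, CRLie.AdStable g 𝔮} =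
      {𝔮 | ∃ A ∈ CRLie.adFixed M₀, 𝔳 ≤ CRLie.q A ∧ 𝔮 = CRLie.q A} := by
  refine ⟨Set.ext fun 𝔮 => ⟨?_, ?_⟩, Set.ext fun 𝔮 => ⟨?_, ?_⟩⟩
  · rintro ⟨⟨hpar, hle, hlevi⟩, hstable⟩
    obtain ⟨A, hA, rfl⟩ := CRLie.isParabolic_and_AdStable_iff.mp ⟨hpar, hstable⟩
    exact ⟨A, hA, hle, hlevi, rfl⟩
  · rintro ⟨A, hA, hle, hlevi, rfl⟩
    obtain ⟨hpar, hstable⟩ := CRLie.isParabolic_and_AdStable_iff.mpr ⟨A, hA, rfl⟩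
    exact ⟨⟨hpar, hle, hlevi⟩, hstable⟩
  · rintro ⟨hpar, hle, hstable⟩
    obtain ⟨A, hA, rfl⟩ := CRLie.isParabolic_and_AdStable_iff.mp ⟨hpar, hstable⟩
    exact ⟨A, hA, hle, rfl⟩
  · rintro ⟨A, hA, hle, rfl⟩
    obtain ⟨hpar, hstable⟩ := CRLie.isParabolic_and_AdStable_iff.mpr ⟨A, hA, rfl⟩
    exact ⟨hpar, hle, hstable⟩

theorem mainTheorem11 {n : ℕ} {K₀ : Type*} [TopologicalSpace K₀] [T2Space K₀] [CompactSpace K₀]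
    [ConnectedSpace K₀] [Group K₀] [ChartedSpace (EuclideanSpace ℝ (Fin n)) K₀]
    [LieGroup (𝓡 n) ∞ K₀] (M₀ : Subgroup K₀) (hM₀ : IsClosed (M₀ : Set K₀))
    (𝔳 : LieSubalgebra ℂ (ℂ ⊗[ℝ] GroupLieAlgebra (𝓡 n) K₀)) :
    CRLie.ParAdm 𝔳 M₀ =
      {𝔮 | ∃ A ∈ CRLie.adFixed M₀, 𝔳 ≤ CRLie.q A ∧
        CRLie.nilr 𝔳 ∩ CRLie.leviPart (CRLie.q A) = {0} ∧ 𝔮 = CRLie.q A} ∧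
    {𝔮 : LieSubalgebra ℂ (ℂ ⊗[ℝ] GroupLieAlgebra (𝓡 n) K₀) |
        CRLie.IsParabolic 𝔮 ∧ 𝔳 ≤ 𝔮 ∧ ∀ g ∈ M₀, CRLie.AdStable g 𝔮} =
      {𝔮 | ∃ A ∈ CRLie.adFixed M₀, 𝔳 ≤ CRLie.q A ∧ 𝔮 = CRLie.q A} :=
  mainTheorem11_general M₀ 𝔳
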